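/- Let $n\ge 1$. Let $K\subset\mathbb{R}^n$ be a convex polytope with the origin in its interior, and let $T\subset\mathbb{R}^n$ be a strictly convex body (compact, strictly convex, with the origin in its interior). **Notation.** For a convex body $C\subset\mathbb{R}^n\times\mathbb{R}^n$ let $\mu_C(x)=\min\{s\ge 0: x\in sC\}$, $H_C=\tfrac12\mu_C^2$ and $J(q,p)=(p,-q)$. A *closed characteristic* on $\partial C$ is an absolutely continuous loop $x:\mathbb{R}/\tau\mathbb{Z}\to\mathbb{R}^n\times\mathbb{R}^n$, for some period $\tau>0$, with $\dot x(t)\in J\,\partial H_C(x(t))$ for almost every $t$ ($\partial H_C$ denoting the subdifferential) and $H_C(x(t))=\tfrac12$ for all $t$. Its *action* is $\mathbb{A}(x)=-\tfrac12\int_0^\tau\langle J\dot x(t),x(t)\rangle\,dt$, and $c_{EHZ}(C)=\min\{\mathbb{A}(x): x\text{ closed characteristic on }\partial C\}$. Let $N_K(z)=\{v:\langle v,y-z\rangle\le 0\ \forall y\in K\}$ for $z\in K$, define $N_T$ likewise, and let $T^\circ=\{x:\langle x,y\rangle\le 1\ \forall y\in T\}$. A *closed $(K,T)$-Minkowski billiard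 trajectory* is a closed polygonal curve $q=(q_1,\dots,q_m)$, $m\ge 2$, with vertices on $\partial K$ (indices modulo $m$; $q_j\ne q_{j+1}$ and $q_j\notin[q_{j-1},q_{j+1}]$ for all $j$), for which there are points $p_1,\dots,p_m\in\partial T$ with $$q_{j+1}-q_j\in N_T(p_j),\qquad p_{j+1}-p_j\in -N_K(q_{j+1})\qquad\text{for all } j.$$ Then $p=(p_1,\dots,p_m)$ is called a *closed dual billiard trajectory* of $q$. The length is $\ell_T(q)=\sum_{j=1}^m\mu_{T^\circ}(q_{j+1}-q_j)$. *Action-minimizing* means of minimal action among all closed characteristics on $\partial(K\times T)$; *$\ell_T$-minimizing* means of minimal $\ell_T$-length among all closed $(K,T)$-Minkowski billiard trajectories. A closed characteristic $x=(x_q,x_p)$ on $\partial(K\times T)$ has the *changing points* $$\dots\to(q_j,p_j)\to(q_{j+1},p_j)\to(q_{j+1},p_{j+1})\to\dots\qquad(j=1,\dots,m)$$ if it runs through these points in this order during one period, at strictly increasing times, with $x_p\equiv p_j$ between $(q_j,p_j)$ and $(q_{j+1},p_j)$, and $x_q\equiv q_{j+1}$ between $(q_{j+1},p_j)$ and $(q_{j+1},p_{j+1})$.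 Two closed characteristics are *equivalent* if they have the same changing points. The *closed polygonal curve through $(q,p)$* is the closed curve that consists of the straight segments joining the consecutive points of the displayed sequence. **Theorem.** 1. For every closed characteristic $x$ on $\partial(K\times T)$ there are a closed $(K,T)$-Minkowski billiard trajectory $q$ with closed dual billiard trajectory $p$ and a closed characteristic $\widetilde x$ on $\partial(K\times T)$ such that $\widetilde x$ is a parametrization of the closed polygonal curve through $(q,p)$, the loops $x$ and $\widetilde x$ are equivalent (both have the changing points given by $(q,p)$), and $$\mathbb{A}(x)=\mathbb{A}(\widetilde x)=\ell_T(q).$$ If $x$ is action-minimizing, then so is $\widetilde x$, and $q$ is $\ell_T$-minimizing. 2. Conversely, for every closed $(K,T)$-Minkowski billiard trajectory $q$ and every closed dual billiard trajectory $p$ of $q$, the closed polygonal curve through $(q,p)$ has a parametrization $x$ that is a closed characteristic on $\partial(K\times T)$ with $\ell_T(q)=\mathbb{A}(x)$. If $q$ is $\ell_T$-minimizing, then $x$ is action-minimizing. 3. In particular, both minima exist and $$c_{EHZ}(K\times T)=\min\{\ell_T(q): q\text{ closed }(K,T)\text{-Minkowski billiard trajectory}\}.$$ -/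

import Mathlib

namespace MinkowskiBilliard

open Set MeasureTheory

section

variable {E : Type*} [NormedAddCommGroup E] [InnerProductSpace ℝ E]

/-! ### Convex bodies -/

/-- A convex body: a compact convex set with the origin in its interior. -/
structure IsConvexBody (K : Set E) : Prop where
  convex : Convex ℝ K
  isCompact : IsCompact K
  zero_mem_interior : (0 : E) ∈ interior K

/-- A convex polytope (as a convex body): the convex hull of finitely many points, with the
origin in its interior. -/
structure IsConvexPolytope (K : Set E) : Prop where
  exists_finite : ∃ S : Set E, S.Finite ∧ K = convexHull ℝ S
  zero_mem_interior : (0 : E) ∈ interior K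

/-- The outer normal cone `N_K(z)`. -/
def normalCone (K : Set E) (z : E) : Set E :=
  {v | ∀ y ∈ K, inner ℝ v (y - z) ≤ 0}

/-- The polar body `T°`. -/
def polarBody (T : Set E) : Set E :=
  {x | ∀ y ∈ T, inner ℝ x y ≤ 1}

/-! ### Phase space `ℝⁿ_q × ℝⁿ_p`, modelled on `E × E` -/

/-- The standard inner product of `ℝⁿ × ℝⁿ`. -/
def pairing (x y : E × E) : ℝ :=
  inner ℝ x.1 y.1 + inner ℝ x.2 y.2

/-- The symplectic matrix `J = (0, 1; -1, 0)`, that is, `J (q, p) = (p, -q)`. -/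
def J (x : E × E) : E × E :=
  (x.2, -x.1)

/-- The subdifferential `∂f(x)` of a function on `ℝⁿ × ℝⁿ`. -/
def subdifferential (f : E × E → ℝ) (x : E × E) : Set (E × E) :=
  {y | ∀ z, f x + pairing y (z - x) ≤ f z}

/-- The Hamiltonian `H_C = μ_C² / 2`, where `μ_C` is the Minkowski functional of `C`. -/
noncomputable def hamiltonian (C : Set (E × E)) (x : E × E) : ℝ :=
  1 / 2 * gauge C x ^ 2

/-- The curve `x : ℝ → ℝⁿ × ℝⁿ` is a closed characteristic on `∂C` with period `τ`: it is
absolutely continuous, a loop on `ℝ / τℤ`, satisfies `ẋ ∈ J ∂H_C(x)` almost everywhere and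
`H_C(x) = 1/2` everywhere. -/
structure IsClosedCharacteristic (C : Set (E × E)) (τ : ℝ) (x : ℝ → E × E) : Prop where
  period_pos : 0 < τ
  periodic : Function.Periodic x τ
  absolutelyContinuous : AbsolutelyContinuousOnInterval x 0 τ
  inclusion : ∀ᵐ t : ℝ, ∃ y ∈ subdifferential (hamiltonian C) (x t), HasDerivAt x (J y) t
  energy : ∀ t, hamiltonian C (x t) = 1 / 2

/-- The action `𝔸(x) = -1/2 ∫ ⟨J ẋ, x⟩ dt` of a loop on `ℝ / τℤ`. -/
noncomputable def action (τ : ℝ) (x : ℝ → E × E) : ℝ :=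
  -(1 / 2) * ∫ t in (0 : ℝ)..τ, pairing (J (deriv x t)) (x t)

/-- The set of actions of all closed characteristics on `∂C`. -/
def actions (C : Set (E × E)) : Set ℝ :=
  {a | ∃ τ x, IsClosedCharacteristic C τ x ∧ a = action τ x}

/-- The EHZ-capacity of `C`. (It is defined as an infimum; that it is a minimum
is `IsLeast (actions C) (ehzCapacity C)`.) -/
noncomputable def ehzCapacity (C : Set (E × E)) : ℝ :=
  sInf (actions C)

/-- An action-minimizing closed characteristic on `∂C`. -/
def IsActionMinimizing (C : Set (E × E)) (τ : ℝ) (x : ℝ → E × E) : Prop :=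
  IsClosedCharacteristic C τ x ∧
    ∀ τ' x', IsClosedCharacteristic C τ' x' → action τ x ≤ action τ' x'

/-! ### Closed Minkowski billiard trajectories

A family indexed by `1, …, m` with indices modulo `m` is a sequence with period `m`. -/

/-- `q` is the sequence of the `m ≥ 2` vertices of a closed polygonal curve: each vertex differs
from the next one and does not lie on the segment connecting its two neighbours. -/
structure IsClosedPolygon (m : ℕ) (q : ℕ → E) : Prop where
  two_le : 2 ≤ m
  periodic : Function.Periodic q m
  ne_succ : ∀ j, q j ≠ q (j + 1)
  notMem_segment : ∀ j, q (j + 1) ∉ segment ℝ (q j) (q (j + 2))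

/-- `q` is a closed (strong) `(K, T)`-Minkowski billiard trajectory with `m` bouncing points, and
`p` is a closed dual billiard trajectory in `T`. -/
structure IsBilliardPair (K T : Set E) (m : ℕ) (q p : ℕ → E) : Prop where
  polygon : IsClosedPolygon m q
  periodic_dual : Function.Periodic p m
  mem_frontier : ∀ j, q j ∈ frontier K
  dual_mem_frontier : ∀ j, p j ∈ frontier T
  sub_mem : ∀ j, q (j + 1) - q j ∈ normalCone T (p j)
  dual_sub_mem : ∀ j, -(p (j + 1) - p j) ∈ normalCone K (q (j + 1))

/-- `q` is a closed (strong) `(K, T)`-Minkowski billiard trajectory with `m` bouncing points. -/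
def IsBilliardTrajectory (K T : Set E) (m : ℕ) (q : ℕ → E) : Prop :=
  ∃ p, IsBilliardPair K T m q p

/-- The `ℓ_T`-length `∑ μ_{T°}(q_{j+1} - q_j)` of a closed polygonal curve. -/
noncomputable def ellLength (T : Set E) (m : ℕ) (q : ℕ → E) : ℝ :=
  ∑ j ∈ Finset.range m, gauge (polarBody T) (q (j + 1) - q j)

/-- The set of `ℓ_T`-lengths of all closed `(K, T)`-Minkowski billiard trajectories. -/
def billiardLengths (K T : Set E) : Set ℝ :=
  {l | ∃ m q, IsBilliardTrajectory K T m q ∧ l = ellLength T m q}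

/-- An `ℓ_T`-minimizing closed `(K, T)`-Minkowski billiard trajectory. -/
def IsLengthMinimizing (K T : Set E) (m : ℕ) (q : ℕ → E) : Prop :=
  IsBilliardTrajectory K T m q ∧
    ∀ m' q', IsBilliardTrajectory K T m' q' → ellLength T m q ≤ ellLength T m' q'

/-! ### Loops in phase space that alternate between motion of `q` and motion of `p` -/

/-- The loop `x` on `ℝ / τℤ` has exactly the changing points
`… → (q_j, p_j) → (q_{j+1}, p_j) → (q_{j+1}, p_{j+1}) → …`: during one period there are
consecutive nondegenerate time intervals on which, alternately, only the `q`-part of `x` moves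
(while the `p`-part rests at `p_j`) and only the `p`-part moves (while the `q`-part rests
at `q_{j+1}`). -/
def HasChangingPoints (τ : ℝ) (x : ℝ → E × E) (m : ℕ) (q p : ℕ → E) : Prop :=
  ∃ t : ℕ → ℝ, (∀ k < 2 * m, t k < t (k + 1)) ∧ t (2 * m) = t 0 + τ ∧
    (∀ j < m, x (t (2 * j)) = (q j, p j) ∧ x (t (2 * j + 1)) = (q (j + 1), p j) ∧
      x (t (2 * j + 2)) = (q (j + 1), p (j + 1))) ∧
    (∀ j < m, ∀ s ∈ Icc (t (2 * j)) (t (2 * j + 1)), (x s).2 = p j) ∧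
    (∀ j < m, ∀ s ∈ Icc (t (2 * j + 1)) (t (2 * j + 2)), (x s).1 = q (j + 1))

/-- The loop `x` on `ℝ / τℤ` is a parametrization of the closed polygonal curve in
`ℝⁿ × ℝⁿ` with the straight segments
`… → (q_j, p_j) → (q_{j+1}, p_j) → (q_{j+1}, p_{j+1}) → …`, each of them traversed with constant
speed (a segment that is a single point may be traversed in no time). -/
def IsPolygonalLoop (τ : ℝ) (x : ℝ → E × E) (m : ℕ) (q p : ℕ → E) : Prop :=
  ∃ t : ℕ → ℝ, (∀ k < 2 * m, t k ≤ t (k + 1)) ∧ t (2 * m) = t 0 + τ ∧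
    (∀ j < m, ∀ s ∈ Icc (0 : ℝ) 1,
      x (AffineMap.lineMap (t (2 * j)) (t (2 * j + 1)) s) =
        (AffineMap.lineMap (q j) (q (j + 1)) s, p j)) ∧
    (∀ j < m, ∀ s ∈ Icc (0 : ℝ) 1,
      x (AffineMap.lineMap (t (2 * j + 1)) (t (2 * j + 2)) s) =
        (q (j + 1), AffineMap.lineMap (p j) (p (j + 1)) s))

end

end MinkowskiBilliard

namespace MinkowskiBilliard

open Set MeasureTheory
open scoped Pointwise

section

variable {E : Type*} [NormedAddCommGroup E] [InnerProductSpace ℝ E]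

/-! On the boundary of `K ×ˢ T` the inclusion `ẋ ∈ J ∂H(x)` says that `q̇ ∈ N_T(p)` and `-ṗ ∈
N_K(q)`, normalized by `⟨q̇, p⟩ - ⟨ṗ, q⟩ = 1` (`IsNormalFlow`). Hence the action is half the period.

The heart is that near any time `t₀`, on either side, `q` or `p` stands still
(`exists_restsOn_left`, `exists_restsOn_right`). Since `K` is a polytope, the normals at points `x`
of `K` near `z = q t₀` are orthogonal to `x - z`. So `⟨q - z, p - p₀⟩` has derivative `⟨q̇, p - p₀⟩
≥ 0` for each `p₀ ∈ T`. With `p₀ = p s` it vanishes at both `s` and `t₀`, so its derivative is zero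
in between, and strict convexity of `T` lets `q` move only while `p = p s`. If `p` takes two values
near `t₀`, then `q` rests. By `exists_alternation` the rests of `q` and `p` alternate finitely often
per period, and the points at the switching times form a billiard trajectory with its dual. A phase
with `p` at rest lasts `⟨q_{j+1} - q_j, p_j⟩`, a term of the `ℓ_T`-length. Summation by parts shows
that the other phases take equally long in total, so the period is twice the length. Conversely,
these durations parametrize the polygon of any billiard pair
(`IsWeakPair.exists_isClosedCharacteristic`).

A minimum exists by a finite-dimensional argument. A polygon in `K` that cannot be translated into
`interior K` carries normals with vanishing sum (`tightPolygons`). With the number of vertices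
fixed, such certified polygons form a compact set, and by Carathéodory every billiard trajectory
contains one with at most `dim E + 1` vertices that is not longer. For a shortest one, duality turns
the normals into a dual polygon in `T` (`exists_isWeakPair_of_minimal`). It may be degenerate, but
it still yields a closed characteristic, whose action is then minimal. -/

theorem IsConvexPolytope.isConvexBody {K : Set E} (hK : IsConvexPolytope K) : IsConvexBody K := by
  obtain ⟨S, hS, rfl⟩ := hK.exists_finite
  exact ⟨convex_convexHull ℝ S, hS.isCompact_convexHull ℝ, hK.zero_mem_interior⟩

/-! ### Normal cones of convex bodies and of polytopes -/

namespace IsConvexBody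

variable {K T : Set E}

theorem zero_mem (hT : IsConvexBody T) : (0 : E) ∈ T := interior_subset hT.zero_mem_interior

theorem mem_nhds (hT : IsConvexBody T) : T ∈ nhds (0 : E) :=
  mem_interior_iff_mem_nhds.1 hT.zero_mem_interior

theorem prod (hK : IsConvexBody K) (hT : IsConvexBody T) :
    Convex ℝ (K ×ˢ T) ∧ IsClosed (K ×ˢ T) ∧ K ×ˢ T ∈ nhds (0 : E × E) :=
  ⟨hK.convex.prod hT.convex, hK.isCompact.isClosed.prod hT.isCompact.isClosed,
    prod_mem_nhds hK.mem_nhds hT.mem_nhds⟩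

/-- `T` contains a ball of radius `r` about the origin, and the normal inequality is tested at `(r /
‖v‖) • v`. This bounds both the speed of characteristics and the normals of tight polygons. -/
theorem exists_mul_norm_le (hT : IsConvexBody T) :
    ∃ r > 0, ∀ p v : E, v ∈ normalCone T p → r * ‖v‖ ≤ inner ℝ v p := by
  obtain ⟨r, hr, hrT⟩ := Metric.nhds_basis_closedBall.mem_iff.1 hT.mem_nhds
  refine ⟨r, hr, fun p v hv => ?_⟩
  rcases eq_or_ne v 0 with rfl | h0
  · simp
  have hn : 0 < ‖v‖ := norm_pos_iff.2 h0
  have hmem : (r / ‖v‖) • v ∈ T := by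
    apply hrT
    rw [mem_closedBall_zero_iff, norm_smul, Real.norm_of_nonneg (by positivity)]
    field_simp
    exact le_rfl
  have := hv _ hmem
  rw [inner_sub_right, inner_smul_right, real_inner_self_eq_norm_sq] at this
  have h2 : r / ‖v‖ * ‖v‖ ^ 2 = r * ‖v‖ := by field_simp
  linarith

theorem inner_nonneg (hT : IsConvexBody T) {p v : E} (hv : v ∈ normalCone T p) :
    0 ≤ (inner ℝ v p : ℝ) := by
  have := hv 0 hT.zero_mem
  rw [zero_sub, inner_neg_right] at this
  linarith

theorem eq_zero_of_inner_eq_zero (hT : IsConvexBody T) {p v : E} (hv : v ∈ normalCone T p)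
    (h : (inner ℝ v p : ℝ) = 0) : v = 0 := by
  obtain ⟨r, hr, H⟩ := hT.exists_mul_norm_le
  have h1 := H p v hv
  rw [h] at h1
  have : ‖v‖ = 0 := by
    have := norm_nonneg v
    nlinarith
  exact norm_eq_zero.1 this

theorem inner_pos (hT : IsConvexBody T) {p v : E} (hv : v ∈ normalCone T p) (h0 : v ≠ 0) :
    0 < (inner ℝ v p : ℝ) :=
  lt_of_le_of_ne (hT.inner_nonneg hv) fun h => h0 (hT.eq_zero_of_inner_eq_zero hv h.symm)

end IsConvexBody

section normalCone

variable {K T : Set E} {v w p q z : E}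

theorem zero_mem_normalCone : (0 : E) ∈ normalCone K z := fun y _ => by simp

theorem smul_mem_normalCone (hv : v ∈ normalCone K z) {c : ℝ} (hc : 0 ≤ c) :
    c • v ∈ normalCone K z := fun y hy => by
  rw [real_inner_smul_left]
  exact mul_nonpos_of_nonneg_of_nonpos hc (hv y hy)

theorem inner_le_of_mem_normalCone (hv : v ∈ normalCone K z) {y : E} (hy : y ∈ K) :
    (inner ℝ v y : ℝ) ≤ inner ℝ v z := by
  have := hv y hy
  rw [inner_sub_right] at this
  linarith

theorem notMem_interior_of_mem_normalCone (hv : v ∈ normalCone K z) (h0 : v ≠ 0) :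
    z ∉ interior K := by
  intro hz
  have h1 : Filter.Tendsto (fun c : ℝ => z + c • v) (nhds 0) (nhds z) := by
    have : Continuous fun c : ℝ => z + c • v := by fun_prop
    simpa using this.tendsto 0
  have h2 : ∀ᶠ c : ℝ in nhdsWithin 0 (Ioi 0), z + c • v ∈ K :=
    (h1.eventually (mem_interior_iff_mem_nhds.1 hz)).filter_mono nhdsWithin_le_nhds
  obtain ⟨c, hc, hc0⟩ := (h2.and self_mem_nhdsWithin).exists
  have h3 := hv _ hc
  rw [add_sub_cancel_left, inner_smul_right, real_inner_self_eq_norm_sq] at h3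
  have : 0 < ‖v‖ := norm_pos_iff.2 h0
  have : 0 < c * ‖v‖ ^ 2 := mul_pos hc0 (by positivity)
  linarith

theorem mem_frontier_of_mem_normalCone (hz : z ∈ K) (hv : v ∈ normalCone K z) (h0 : v ≠ 0) :
    z ∈ frontier K :=
  ⟨subset_closure hz, notMem_interior_of_mem_normalCone hv h0⟩

/-- A nonzero vector is normal to a strictly convex set in at most one point. -/
theorem eq_of_inner_sub_eq_zero (hTs : StrictConvex ℝ T) (hp : p ∈ T) (hq : q ∈ T)
    (hv : v ∈ normalCone T p) (h0 : v ≠ 0) (h : (inner ℝ v (q - p) : ℝ) = 0) : q = p := by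
  by_contra hne
  have h1 : (1 / 2 : ℝ) • q + (1 / 2 : ℝ) • p ∈ interior T :=
    hTs hq hp hne (by norm_num) (by norm_num) (by norm_num)
  refine notMem_interior_of_mem_normalCone (v := v) (fun y hy => ?_) h0 h1
  have h2 := hv y hy
  rw [inner_sub_right] at h h2 ⊢
  rw [inner_add_right, inner_smul_right, inner_smul_right]
  linarith

/-- The gauge of the polar body is the support function of `T`, and a vector normal at `p` attains
its maximum over `T` at `p`. -/
theorem gauge_polarBody (hT : IsConvexBody T) (hp : p ∈ T)
    (hv : v ∈ normalCone T p) : gauge (polarBody T) v = inner ℝ v p := by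
  have key : ∀ r : ℝ, 0 < r → (v ∈ r • polarBody T ↔ (inner ℝ v p : ℝ) ≤ r) := by
    intro r hr
    rw [mem_smul_set_iff_inv_smul_mem₀ hr.ne']
    constructor
    · intro h
      have := h p hp
      rw [real_inner_smul_left, inv_mul_le_iff₀ hr] at this
      linarith
    · intro h y hy
      rw [real_inner_smul_left, inv_mul_le_iff₀ hr, mul_one]
      exact (inner_le_of_mem_normalCone hv hy).trans h
  have h0 := hT.inner_nonneg hv
  refine le_antisymm ?_ ?_
  · refine le_of_forall_pos_le_add fun ε hε => ?_
    exact gauge_le_of_mem (by linarith) ((key _ (by linarith)).2 (by linarith))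
  · rw [gauge_def]
    refine le_csInf ⟨inner ℝ v p + 1, by simp only [mem_Ioi]; linarith,
      (key _ (by linarith)).2 (by linarith)⟩ ?_
    rintro r ⟨hr, h⟩
    exact (key r hr).1 h

end normalCone

/-- Near a point `z`, all normals of a polytope are orthogonal to the direction of `z`. -/
theorem IsConvexPolytope.eventually_inner_sub_eq_zero {K : Set E} (hK : IsConvexPolytope K)
    (z : E) : ∀ᶠ x in nhds z, x ∈ K → ∀ v ∈ normalCone K x, (inner ℝ v (x - z) : ℝ) = 0 := by
  obtain ⟨S, hS, rfl⟩ := hK.exists_finite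
  -- The finite set `S` has finitely many subsets, with closed hulls, so a point close to `z` lies
  -- only in those hulls that contain `z`.
  have h1 : ∀ᶠ x in nhds z, ∀ A ∈ {A | A ⊆ S}, x ∈ convexHull ℝ A → z ∈ convexHull ℝ A := by
    refine (Filter.eventually_all_finite hS.finite_subsets).2 fun A hA => ?_
    by_cases hz : z ∈ convexHull ℝ A
    · exact Filter.Eventually.of_forall fun _ _ => hz
    · have hcl : IsClosed (convexHull ℝ A) := (hS.subset hA).isClosed_convexHull ℝ
      filter_upwards [hcl.isOpen_compl.mem_nhds hz] with x hx hx'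
      exact absurd hx' hx
  filter_upwards [h1] with x hx hxK v hv
  -- `A` spans the face exposed by `v`. In a convex combination giving `x`, weights outside `A`
  -- vanish because `⟨v, x⟩` is the maximum. Then `z` lies in the same face.
  set A : Set E := {s ∈ S | (inner ℝ v s : ℝ) = inner ℝ v x} with hA
  have hxA : x ∈ convexHull ℝ A := by
    rw [hS.convexHull_eq] at hxK
    obtain ⟨w, hw0, hw1, hwx⟩ := hxK
    have hle : ∀ s ∈ S, (inner ℝ v s : ℝ) ≤ inner ℝ v x := fun s hs =>
      inner_le_of_mem_normalCone hv (subset_convexHull ℝ S hs)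
    have hsum : ∑ s ∈ hS.toFinset, w s * (inner ℝ v x - inner ℝ v s : ℝ) = 0 := by
      simp only [mul_sub, Finset.sum_sub_distrib, ← Finset.sum_mul, hw1]
      rw [← hwx, Finset.centerMass_eq_of_sum_1 _ _ hw1, inner_sum]
      simp [inner_smul_right]
    have hz := (Finset.sum_eq_zero_iff_of_nonneg (fun s hs => mul_nonneg
      (hw0 s (hS.mem_toFinset.1 hs)) (sub_nonneg.2 (hle s (hS.mem_toFinset.1 hs))))).1 hsum
    rw [← hwx]
    classical
    rw [← Finset.centerMass_filter_ne_zero]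
    refine Finset.centerMass_mem_convexHull _ (fun s hs => ?_) ?_ fun s hs => ?_
    · exact hw0 s (hS.mem_toFinset.1 (Finset.mem_filter.1 hs).1)
    · rw [Finset.sum_filter_ne_zero, hw1]
      exact one_pos
    · obtain ⟨hs1, hs2⟩ := Finset.mem_filter.1 hs
      refine ⟨hS.mem_toFinset.1 hs1, ?_⟩
      rcases mul_eq_zero.1 (hz s hs1) with h | h
      · exact absurd h hs2
      · exact (sub_eq_zero.1 h).symm
  have hzA := hx A (sep_subset _ _) hxA
  have : convexHull ℝ A ⊆ {y | (inner ℝ v y : ℝ) = inner ℝ v x} := by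
    refine convexHull_min (fun s hs => hs.2) ?_
    exact convex_hyperplane (f := fun y => (inner ℝ v y : ℝ))
      ⟨fun a b => inner_add_right _ _ _, fun c a => inner_smul_right _ _ _⟩ _
  rw [inner_sub_right, this hzA, sub_self]

/-! ### The Hamiltonian inclusion in terms of normal cones -/

section phaseSpace

variable {K T : Set E} {x y z : E × E}

theorem pairing_sub : pairing y (z - x) = pairing y z - pairing y x := by
  simp only [pairing, Prod.fst_sub, Prod.snd_sub, inner_sub_right]
  ring

theorem pairing_smul (c : ℝ) : pairing y (c • x) = c * pairing y x := by
  simp only [pairing, Prod.smul_fst, Prod.smul_snd, inner_smul_right]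
  ring

theorem hamiltonian_eq_half {C : Set (E × E)} : hamiltonian C x = 1 / 2 ↔ gauge C x = 1 := by
  have := gauge_nonneg (s := C) x
  unfold hamiltonian
  constructor
  · intro h
    nlinarith
  · intro h
    rw [h]; norm_num

theorem mem_prod_of_hamiltonian (hK : IsConvexBody K) (hT : IsConvexBody T)
    (hx : hamiltonian (K ×ˢ T) x = 1 / 2) : x ∈ K ×ˢ T := by
  obtain ⟨h1, h2, h3⟩ := hK.prod hT
  have := (gauge_le_one_iff_mem_closure h1 h3).1 (hamiltonian_eq_half.1 hx).le
  rwa [h2.closure_eq] at this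

/-- Euler's identity for a function homogeneous of degree two: compare values along the ray through
`x`. -/
theorem pairing_eq_one_of_mem_subdifferential
    (hx : hamiltonian (K ×ˢ T) x = 1 / 2) (hy : y ∈ subdifferential (hamiltonian (K ×ˢ T)) x) :
    pairing y x = 1 := by
  have h1 : ∀ s : ℝ, 0 ≤ s → 1 / 2 + (s - 1) * pairing y x ≤ 1 / 2 * s ^ 2 := by
    intro s hs
    have := hy (s • x)
    rw [hx, pairing_sub, pairing_smul] at this
    unfold hamiltonian at this
    rw [gauge_smul_of_nonneg hs, hamiltonian_eq_half.1 hx, smul_eq_mul, mul_one] at this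
    linarith
  set a := pairing y x
  by_contra hne
  rcases lt_or_gt_of_ne hne with h | h
  -- Any `s ≥ 0` strictly between `a` and `1` gives a contradiction; the maximum with `1 / 2` keeps
  -- `s` nonnegative.
  · have h2 := h1 ((max a (1 / 2) + 1) / 2) (by have := le_max_right a (1 / 2); linarith)
    have h3 := le_max_left a (1 / 2)
    have h4 : max a (1 / 2) < 1 := max_lt h (by norm_num)
    nlinarith
  · have h2 := h1 ((a + 1) / 2) (by linarith)
    nlinarith

/-- The Hamiltonian is at most `1 / 2` on the product, so `y` is normal to it at `x`; varying one
factor at a time splits the normal. -/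
theorem mem_normalCone_of_mem_subdifferential (hK : IsConvexBody K) (hT : IsConvexBody T)
    (hx : hamiltonian (K ×ˢ T) x = 1 / 2) (hy : y ∈ subdifferential (hamiltonian (K ×ˢ T)) x) :
    y.1 ∈ normalCone K x.1 ∧ y.2 ∈ normalCone T x.2 := by
  have hmem := mem_prod_of_hamiltonian hK hT hx
  have key : ∀ z ∈ K ×ˢ T, pairing y (z - x) ≤ 0 := by
    intro z hz
    have h1 := hy z
    have h2 : hamiltonian (K ×ˢ T) z ≤ 1 / 2 := by
      have := gauge_le_one_of_mem hz
      have := gauge_nonneg (s := K ×ˢ T) z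
      unfold hamiltonian
      nlinarith
    linarith
  constructor
  · intro k hk
    simpa [pairing] using key (k, x.2) ⟨hk, hmem.2⟩
  · intro k hk
    simpa [pairing] using key (x.1, k) ⟨hmem.1, hk⟩

/-- The linear form of `y` is at most `1` on `K ×ˢ T`, hence bounded by the gauge `μ`, and `1 / 2 +
(μ - 1) ≤ μ ^ 2 / 2`. -/
theorem mem_subdifferential_of_mem_normalCone (hK : IsConvexBody K) (hT : IsConvexBody T)
    (hx : hamiltonian (K ×ˢ T) x = 1 / 2) (h1 : y.1 ∈ normalCone K x.1)
    (h2 : y.2 ∈ normalCone T x.2) (h : pairing y x = 1) :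
    y ∈ subdifferential (hamiltonian (K ×ˢ T)) x := by
  intro z
  have h3 : pairing y z ≤ gauge (K ×ˢ T) z := by
    rw [gauge_def]
    refine le_csInf (absorbent_nhds_zero (hK.prod hT).2.2).gauge_set_nonempty ?_
    rintro r ⟨hr, c, hc, rfl⟩
    have hr' : (0 : ℝ) < r := hr
    have h4 : pairing y c ≤ 1 := by
      have := inner_le_of_mem_normalCone h1 hc.1
      have := inner_le_of_mem_normalCone h2 hc.2
      simp only [pairing] at h ⊢
      linarith
    have : pairing y (r • c) = r * pairing y c := pairing_smul r
    simp only [this]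
    nlinarith
  rw [hx, pairing_sub, h]
  unfold hamiltonian
  nlinarith [sq_nonneg (gauge (K ×ˢ T) z - 1)]

theorem hamiltonian_prod_eq_half (hK : IsConvexBody K) (hT : IsConvexBody T)
    (hx : x ∈ K ×ˢ T) (h : x.1 ∈ frontier K ∨ x.2 ∈ frontier T) :
    hamiltonian (K ×ˢ T) x = 1 / 2 := by
  obtain ⟨h1, h2, h3⟩ := hK.prod hT
  rw [hamiltonian_eq_half, gauge_eq_one_iff_mem_frontier h1 h3]
  refine ⟨subset_closure hx, ?_⟩
  rw [interior_prod_eq]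
  rintro ⟨h4, h5⟩
  exact h.elim (fun h => h.2 h4) fun h => h.2 h5

end phaseSpace

end

/-! ### Absolutely continuous curves and derivatives almost everywhere -/

section absolutelyContinuous

open Filter AbsolutelyContinuousOnInterval

variable {F G : Type*} [PseudoMetricSpace F] [PseudoMetricSpace G]

theorem _root_.LipschitzWith.comp_absolutelyContinuousOnInterval {L : NNReal} {g : F → G}
    (hg : LipschitzWith L g) {f : ℝ → F} {a b : ℝ} (hf : AbsolutelyContinuousOnInterval f a b) :
    AbsolutelyContinuousOnInterval (fun t => g (f t)) a b := by
  refine squeeze_zero (fun t => Finset.sum_nonneg fun _ _ => dist_nonneg) (fun t => ?_)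
    (by simpa using Tendsto.const_mul (L : ℝ) hf)
  rw [Finset.mul_sum]
  exact Finset.sum_le_sum fun i _ => hg.dist_le_mul _ _

/-- Polarization reduces the inner product to squares of the real functions `‖u + w‖` and `‖u - w‖`.
-/
theorem absolutelyContinuousOnInterval_inner {E : Type*} [NormedAddCommGroup E]
    [InnerProductSpace ℝ E] {u w : ℝ → E} {a b : ℝ}
    (hu : AbsolutelyContinuousOnInterval u a b) (hw : AbsolutelyContinuousOnInterval w a b) :
    AbsolutelyContinuousOnInterval (fun t => (inner ℝ (u t) (w t) : ℝ)) a b := by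
  have h1 := lipschitzWith_one_norm.comp_absolutelyContinuousOnInterval (hu.add hw)
  have h2 := lipschitzWith_one_norm.comp_absolutelyContinuousOnInterval (hu.sub hw)
  have h3 := ((h1.mul h1).sub (h2.mul h2)).const_mul (1 / 4)
  convert h3 using 2 with t
  simp only [Pi.sub_apply, Pi.mul_apply, Pi.add_apply]
  rw [norm_add_mul_self_real, norm_sub_mul_self_real]
  ring

theorem le_of_ae_hasDerivAt_nonneg {f : ℝ → ℝ} {a b : ℝ} (hab : a ≤ b)
    (hf : AbsolutelyContinuousOnInterval f a b)
    (h : ∀ᵐ t, t ∈ Ioo a b → ∃ d, HasDerivAt f d t ∧ 0 ≤ d) : f a ≤ f b := by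
  rw [← sub_nonneg, ← hf.integral_deriv_eq_sub, intervalIntegral.integral_of_le hab,
    integral_Ioc_eq_integral_Ioo]
  refine setIntegral_nonneg_ae measurableSet_Ioo ?_
  filter_upwards [h] with t ht hmem
  obtain ⟨d, hd, h0⟩ := ht hmem
  rwa [hd.deriv]

theorem sub_eq_of_ae_hasDerivAt {f : ℝ → ℝ} {a b c : ℝ} (hab : a ≤ b)
    (hf : AbsolutelyContinuousOnInterval f a b)
    (h : ∀ᵐ t, t ∈ Ioo a b → HasDerivAt f c t) : f b - f a = c * (b - a) := by
  rw [← hf.integral_deriv_eq_sub, intervalIntegral.integral_of_le hab,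
    integral_Ioc_eq_integral_Ioo]
  rw [setIntegral_congr_ae (g := fun _ => c) measurableSet_Ioo]
  · simp [hab, mul_comm]
  · filter_upwards [h] with t ht hmem
    exact (ht hmem).deriv

/-- A monotone function with equal values at the ends is constant. -/
theorem ae_deriv_eq_zero_of_nonneg {f : ℝ → ℝ} {a b : ℝ}
    (hf : AbsolutelyContinuousOnInterval f a b)
    (h : ∀ᵐ t, t ∈ Ioo a b → ∃ d, HasDerivAt f d t ∧ 0 ≤ d) (heq : f a = f b) :
    ∀ t ∈ Ioo a b, ∀ d, HasDerivAt f d t → d = 0 := by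
  have hconst : ∀ t ∈ Ioo a b, f t = f a := by
    intro t ht
    have hab : a ≤ b := (ht.1.trans ht.2).le
    refine le_antisymm ?_ ?_
    · rw [heq]
      refine le_of_ae_hasDerivAt_nonneg ht.2.le (hf.mono ?_) ?_
      · rw [uIcc_of_le ht.2.le, uIcc_of_le hab]
        exact Icc_subset_Icc_left ht.1.le
      · filter_upwards [h] with s hs hmem using hs (Ioo_subset_Ioo_left ht.1.le hmem)
    · refine le_of_ae_hasDerivAt_nonneg ht.1.le (hf.mono ?_) ?_
      · rw [uIcc_of_le ht.1.le, uIcc_of_le hab]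
        exact Icc_subset_Icc_right ht.2.le
      · filter_upwards [h] with s hs hmem using hs (Ioo_subset_Ioo_right ht.2.le hmem)
  intro t ht d hd
  have h1 : f =ᶠ[nhds t] fun _ => f a := by
    filter_upwards [Ioo_mem_nhds ht.1 ht.2] with s hs using hconst s hs
  exact hd.unique ((hasDerivAt_const t (f a)).congr_of_eventuallyEq h1)

/-- Pairing the curve with its own displacement `v` leaves only a real function to integrate. -/
theorem norm_sub_le_of_ae_hasDerivAt {E : Type*} [NormedAddCommGroup E] [InnerProductSpace ℝ E]
    {u : ℝ → E} {a b M : ℝ} (hab : a ≤ b) (hu : AbsolutelyContinuousOnInterval u a b)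
    (h : ∀ᵐ t, t ∈ Ioo a b → ∃ d, HasDerivAt u d t ∧ ‖d‖ ≤ M) : ‖u b - u a‖ ≤ M * (b - a) := by
  set v := u b - u a with hv
  have hM : ∀ d : E, ‖d‖ ≤ M → (inner ℝ v d : ℝ) ≤ M * ‖v‖ := fun d hd =>
    (real_inner_le_norm v d).trans (by rw [mul_comm]; gcongr)
  have hid : AbsolutelyContinuousOnInterval (fun t : ℝ => t) a b :=
    (LipschitzWith.id.lipschitzOnWith).absolutelyContinuousOnInterval
  have hc : AbsolutelyContinuousOnInterval (fun _ : ℝ => v) a b :=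
    ((LipschitzWith.const v).lipschitzOnWith).absolutelyContinuousOnInterval
  have h1 := le_of_ae_hasDerivAt_nonneg hab
    (f := fun t => (M * ‖v‖) * t - inner ℝ v (u t))
    ((hid.const_mul (M * ‖v‖)).sub (absolutelyContinuousOnInterval_inner hc hu)) (by
      filter_upwards [h] with t ht hmem
      obtain ⟨d, hd, hdM⟩ := ht hmem
      refine ⟨_, ((hasDerivAt_id t).const_mul (M * ‖v‖)).sub
        ((hasDerivAt_const t v).inner ℝ hd), ?_⟩
      have := hM d hdM
      simp only [inner_zero_left, add_zero, mul_one]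
      linarith)
  have h2 : (inner ℝ v (u b) - inner ℝ v (u a) : ℝ) = ‖v‖ ^ 2 := by
    rw [← inner_sub_right, ← hv, real_inner_self_eq_norm_sq]
  rcases (norm_nonneg v).eq_or_lt with h0 | h0
  · rcases hab.eq_or_lt with rfl | hab'
    · simp [hv]
    · rw [← h0]
      -- For `v = 0` the claim still needs `0 ≤ M`, which any one derivative in the interval
      -- supplies.
      have : ∃ t, t ∈ Ioo a b ∧ ∃ d, HasDerivAt u d t ∧ ‖d‖ ≤ M := by
        by_contra! hcon
        have : volume (Ioo a b) = 0 := by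
          rw [← compl_compl (Ioo a b)]
          refine mem_ae_iff.1 ?_
          filter_upwards [h] with t ht hmem
          obtain ⟨d, hd, hdM⟩ := ht hmem
          exact (hcon t hmem d hd).not_ge hdM
        simp at this
        linarith
      obtain ⟨t, -, d, -, hdM⟩ := this
      have := (norm_nonneg d).trans hdM
      have : 0 ≤ b - a := by linarith
      positivity
  · have : ‖v‖ * ‖v‖ ≤ ‖v‖ * (M * (b - a)) := by nlinarith
    exact le_of_mul_le_mul_left this h0

end absolutelyContinuous

/-! ### Closed characteristics as Lipschitz flows along normals -/

section

variable {E : Type*} [NormedAddCommGroup E] [InnerProductSpace ℝ E]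

theorem lipschitz_of_periodic {F : Type*} [SeminormedAddCommGroup F] {u : ℝ → F} {τ M : ℝ}
    (hτ : 0 < τ) (hu : Function.Periodic u τ)
    (h : ∀ a b, 0 ≤ a → a ≤ b → b ≤ τ → ‖u b - u a‖ ≤ M * (b - a)) :
    ∀ a b, a ≤ b → ‖u b - u a‖ ≤ M * (b - a) := by
  have hn : ∀ n : ℕ, ∀ a b, 0 ≤ a → a ≤ b → b ≤ n * τ → ‖u b - u a‖ ≤ M * (b - a) := by
    intro n
    induction n with
    | zero =>
      intro a b ha hab hb
      have : a = b := by push_cast at hb; linarith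
      simp [this]
    | succ n ih =>
      intro a b ha hab hb
      push_cast at hb
      have hshift : ∀ a b, n * τ ≤ a → a ≤ b → b ≤ (n + 1) * τ →
          ‖u b - u a‖ ≤ M * (b - a) := by
        intro a b ha hab hb
        have := h (a - n * τ) (b - n * τ) (by linarith) (by linarith) (by linarith)
        rwa [hu.sub_nat_mul_eq, hu.sub_nat_mul_eq, sub_sub_sub_cancel_right] at this
      rcases le_total b (n * τ) with hb' | hb'
      · exact ih a b ha hab hb'
      rcases le_total (n * τ) a with ha' | ha'
      · exact hshift a b ha' hab hb
      have h1 := ih a (n * τ) ha ha' le_rfl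
      have h2 := hshift (n * τ) b le_rfl hb' hb
      calc ‖u b - u a‖ ≤ ‖u b - u (n * τ)‖ + ‖u (n * τ) - u a‖ :=
            norm_sub_le_norm_sub_add_norm_sub _ _ _
        _ ≤ M * (b - a) := by linarith
  intro a b hab
  obtain ⟨n, hn'⟩ := exists_nat_ge ((b - ⌊a / τ⌋ * τ) / τ)
  have hf := Int.floor_le (a / τ)
  rw [le_div_iff₀ hτ] at hf
  rw [div_le_iff₀ hτ] at hn'
  have := hn n (a - ⌊a / τ⌋ * τ) (b - ⌊a / τ⌋ * τ) (by linarith) (by linarith) hn'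
  rwa [hu.sub_int_mul_eq, hu.sub_int_mul_eq, sub_sub_sub_cancel_right] at this

/-- The pair `(q, p)` of Lipschitz curves in `K` and `T` moves by outer normals:
`q̇ ∈ N_T(p)` and `-ṗ ∈ N_K(q)`, with the normalization `⟨q̇, p⟩ - ⟨ṗ, q⟩ = 1`. -/
structure IsNormalFlow (K T : Set E) (q p : ℝ → E) : Prop where
  lipschitz_fst : ∃ L, LipschitzWith L q
  lipschitz_snd : ∃ L, LipschitzWith L p
  mem_fst : ∀ t, q t ∈ K
  mem_snd : ∀ t, p t ∈ T
  ae_deriv : ∀ᵐ t : ℝ, ∃ v w, HasDerivAt q v t ∧ HasDerivAt p (-w) t ∧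
    v ∈ normalCone T (p t) ∧ w ∈ normalCone K (q t) ∧ (inner ℝ v (p t) + inner ℝ w (q t) : ℝ) = 1

theorem exists_lipschitzWith {F : Type*} [SeminormedAddCommGroup F] {u : ℝ → F} {M : ℝ}
    (h : ∀ a b, a ≤ b → ‖u b - u a‖ ≤ M * (b - a)) : ∃ L, LipschitzWith L u := by
  refine ⟨M.toNNReal, LipschitzWith.of_dist_le_mul fun a b => ?_⟩
  have hM : ∀ a b, a ≤ b → ‖u b - u a‖ ≤ M.toNNReal * |b - a| := fun a b hab => by
    rw [abs_of_nonneg (by linarith)]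
    exact (h a b hab).trans
      (mul_le_mul_of_nonneg_right (Real.le_coe_toNNReal M) (by linarith))
  rw [dist_eq_norm, Real.dist_eq]
  rcases le_total a b with hab | hab
  · rw [norm_sub_rev, abs_sub_comm]
    exact hM a b hab
  · exact hM b a hab

namespace IsClosedCharacteristic

variable {K T : Set E} {τ : ℝ} {x : ℝ → E × E}

/-- The two terms of the normalization are nonnegative with sum `1`, so each is at most `1`;
`exists_mul_norm_le` then bounds both velocities. -/
theorem isNormalFlow (hK : IsConvexBody K) (hT : IsConvexBody T)
    (hx : IsClosedCharacteristic (K ×ˢ T) τ x) :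
    IsNormalFlow K T (fun t => (x t).1) fun t => (x t).2 := by
  have hmem := fun t => mem_prod_of_hamiltonian hK hT (hx.energy t)
  have hae : ∀ᵐ t : ℝ, ∃ v w, HasDerivAt (fun t => (x t).1) v t ∧
      HasDerivAt (fun t => (x t).2) (-w) t ∧ v ∈ normalCone T (x t).2 ∧
      w ∈ normalCone K (x t).1 ∧ (inner ℝ v (x t).2 + inner ℝ w (x t).1 : ℝ) = 1 := by
    filter_upwards [hx.inclusion] with t ht
    obtain ⟨y, hy, hd⟩ := ht
    obtain ⟨h1, h2⟩ := mem_normalCone_of_mem_subdifferential hK hT (hx.energy t) hy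
    have h3 := pairing_eq_one_of_mem_subdifferential (hx.energy t) hy
    refine ⟨y.2, y.1, hd.fst, hd.snd, h2, h1, ?_⟩
    rw [add_comm]
    exact h3
  have hper1 : Function.Periodic (fun t => (x t).1) τ := fun t => by simp only [hx.periodic t]
  have hper2 : Function.Periodic (fun t => (x t).2) τ := fun t => by simp only [hx.periodic t]
  have hsub : ∀ a b, 0 ≤ a → a ≤ b → b ≤ τ → uIcc a b ⊆ uIcc 0 τ := by
    intro a b ha hab hb
    rw [uIcc_of_le hab, uIcc_of_le hx.period_pos.le]
    exact Icc_subset_Icc ha hb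
  obtain ⟨r, hr, hrT⟩ := hT.exists_mul_norm_le
  obtain ⟨s, hs, hsK⟩ := hK.exists_mul_norm_le
  refine ⟨exists_lipschitzWith (lipschitz_of_periodic hx.period_pos hper1 (M := 1 / r) ?_),
    exists_lipschitzWith (lipschitz_of_periodic hx.period_pos hper2 (M := 1 / s) ?_),
    fun t => (hmem t).1, fun t => (hmem t).2, hae⟩
  · intro a b ha hab hb
    refine norm_sub_le_of_ae_hasDerivAt hab
      (LipschitzWith.prod_fst.comp_absolutelyContinuousOnInterval
      (hx.absolutelyContinuous.mono (hsub a b ha hab hb))) ?_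
    filter_upwards [hae] with t ⟨v, w, hv, hw, hvT, hwK, h⟩ _
    refine ⟨v, hv, ?_⟩
    have := hrT _ _ hvT
    have := hK.inner_nonneg hwK
    rw [le_div_iff₀ hr]
    linarith
  · intro a b ha hab hb
    refine norm_sub_le_of_ae_hasDerivAt hab
      (LipschitzWith.prod_snd.comp_absolutelyContinuousOnInterval
      (hx.absolutelyContinuous.mono (hsub a b ha hab hb))) ?_
    filter_upwards [hae] with t ⟨v, w, hv, hw, hvT, hwK, h⟩ _
    refine ⟨-w, hw, ?_⟩
    have := hsK _ _ hwK
    have := hT.inner_nonneg hvT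
    rw [le_div_iff₀ hs, norm_neg]
    linarith

/-- As `J` squares to `-1`, the integrand is `-pairing y x = -1`. -/
theorem action_eq (hx : IsClosedCharacteristic (K ×ˢ T) τ x) : action τ x = τ / 2 := by
  have : ∫ t in (0 : ℝ)..τ, pairing (J (deriv x t)) (x t) = ∫ t in (0 : ℝ)..τ, (-1 : ℝ) := by
    refine intervalIntegral.integral_congr_ae ?_
    filter_upwards [hx.inclusion] with t ht _
    obtain ⟨y, hy, hd⟩ := ht
    have h3 := pairing_eq_one_of_mem_subdifferential (hx.energy t) hy
    rw [hd.deriv]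
    simp only [pairing, J, inner_neg_left] at h3 ⊢
    linarith
  rw [action, this]
  simp
  ring

end IsClosedCharacteristic

end

/-! ### Intervals of rest -/

section

variable {E : Type*}

/-- The curve `f` is constant on `[a, b]`. -/
def RestsOn (f : ℝ → E) (a b : ℝ) : Prop :=
  ∀ s ∈ Icc a b, ∀ t ∈ Icc a b, f s = f t

theorem RestsOn.mono {f : ℝ → E} {a b c d : ℝ} (h : RestsOn f a b) (hac : a ≤ c) (hdb : d ≤ b) :
    RestsOn f c d := fun s hs t ht =>
  h s (Icc_subset_Icc hac hdb hs) t (Icc_subset_Icc hac hdb ht)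

theorem RestsOn.trans {f : ℝ → E} {a b c : ℝ} (hab : RestsOn f a b) (hbc : RestsOn f b c) :
    RestsOn f a c := by
  have key : ∀ s ∈ Icc a c, ∀ t ∈ Icc a c, s ≤ t → f s = f t := by
    intro s hs t ht hst
    rcases le_total t b with htb | htb
    · exact hab s ⟨hs.1, hst.trans htb⟩ t ⟨ht.1, htb⟩
    rcases le_total b s with hbs | hbs
    · exact hbc s ⟨hbs, hs.2⟩ t ⟨htb, ht.2⟩
    · exact (hab s ⟨hs.1, hbs⟩ b ⟨hs.1.trans hbs, le_rfl⟩).trans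
        (hbc b ⟨le_rfl, htb.trans ht.2⟩ t ⟨htb, ht.2⟩)
  intro s hs t ht
  rcases le_total s t with hst | hst
  · exact key s hs t ht hst
  · exact (key t ht s hs hst).symm

theorem RestsOn.add_period {f : ℝ → E} {a b τ : ℝ} (hf : Function.Periodic f τ) :
    RestsOn f (a + τ) (b + τ) ↔ RestsOn f a b := by
  constructor
  · intro h s hs t ht
    rw [← hf s, ← hf t]
    exact h _ ⟨by linarith [hs.1], by linarith [hs.2]⟩ _ ⟨by linarith [ht.1], by linarith [ht.2]⟩
  · intro h s hs t ht
    rw [← hf.sub_eq s, ← hf.sub_eq t]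
    exact h _ ⟨by linarith [hs.1], by linarith [hs.2]⟩ _ ⟨by linarith [ht.1], by linarith [ht.2]⟩

variable [NormedAddCommGroup E] {a b : ℝ}

theorem restsOn_of_Ico {f : ℝ → E} (hf : Continuous f) (hab : a < b)
    (h : ∀ s ∈ Ico a b, ∀ t ∈ Ico a b, f s = f t) : RestsOn f a b := by
  have h1 : closure (Ico a b) ⊆ {t | f t = f a} :=
    closure_minimal (fun t ht => h t ht a ⟨le_rfl, hab⟩) (isClosed_eq hf continuous_const)
  rw [closure_Ico hab.ne] at h1
  exact fun s hs t ht => (h1 hs).trans (h1 ht).symm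

theorem restsOn_of_Ioc {f : ℝ → E} (hf : Continuous f) (hab : a < b)
    (h : ∀ s ∈ Ioc a b, ∀ t ∈ Ioc a b, f s = f t) : RestsOn f a b := by
  have h1 : closure (Ioc a b) ⊆ {t | f t = f b} :=
    closure_minimal (fun t ht => h t ht b ⟨hab, le_rfl⟩) (isClosed_eq hf continuous_const)
  rw [closure_Ioc hab.ne] at h1
  exact fun s hs t ht => (h1 hs).trans (h1 ht).symm

theorem _root_.LipschitzWith.absolutelyContinuousOnInterval {f : ℝ → E} {L : NNReal}
    (hf : LipschitzWith L f) (a b : ℝ) : AbsolutelyContinuousOnInterval f a b :=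
  hf.lipschitzOnWith.absolutelyContinuousOnInterval

variable [InnerProductSpace ℝ E] {K T : Set E} {q p : ℝ → E}

theorem RestsOn.hasDerivAt {f : ℝ → E} (h : RestsOn f a b) {t : ℝ} (ht : t ∈ Ioo a b) :
    HasDerivAt f 0 t := by
  refine (hasDerivAt_const t (f t)).congr_of_eventuallyEq ?_
  filter_upwards [Ioo_mem_nhds ht.1 ht.2] with s hs
  exact h s (Ioo_subset_Icc_self hs) t (Ioo_subset_Icc_self ht)

namespace IsNormalFlow

variable (h : IsNormalFlow K T q p)

include h

theorem continuous_fst : Continuous q := h.lipschitz_fst.choose_spec.continuous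

theorem continuous_snd : Continuous p := h.lipschitz_snd.choose_spec.continuous

theorem ac_fst (a b : ℝ) : AbsolutelyContinuousOnInterval q a b :=
  h.lipschitz_fst.choose_spec.absolutelyContinuousOnInterval a b

theorem ac_snd (a b : ℝ) : AbsolutelyContinuousOnInterval p a b :=
  h.lipschitz_snd.choose_spec.absolutelyContinuousOnInterval a b

/-- While `p` rests, `q̇` stays in one fixed convex cone, which then contains the displacement. -/
theorem sub_mem_normalCone_of_restsOn_snd (hab : a ≤ b) (hp : RestsOn p a b) :
    q b - q a ∈ normalCone T (p a) := by
  intro y hy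
  have h1 := le_of_ae_hasDerivAt_nonneg hab (f := fun t => (inner ℝ (q t) (p a - y) : ℝ))
    (absolutelyContinuousOnInterval_inner (h.ac_fst a b)
      ((LipschitzWith.const _).absolutelyContinuousOnInterval a b)) (by
      filter_upwards [h.ae_deriv] with t ⟨v, w, hv, hw, hvT, hwK, he⟩ ht
      refine ⟨_, hv.inner ℝ (hasDerivAt_const t (p a - y)), ?_⟩
      have h2 := hvT y hy
      rw [hp t (Ioo_subset_Icc_self ht) a ⟨le_rfl, hab⟩, ← neg_sub, inner_neg_right] at h2
      rw [inner_zero_right, zero_add]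
      linarith)
  rw [← neg_sub (p a) y, inner_neg_right, inner_sub_left]
  linarith

/-- While `p` rests, `ṗ = 0` and the normalization reduces to `⟨q̇, p⟩ = 1`. This reads elapsed time
off the polygon. -/
theorem inner_sub_of_restsOn_snd (hab : a ≤ b) (hp : RestsOn p a b) :
    (inner ℝ (q b - q a) (p a) : ℝ) = b - a := by
  have h1 := sub_eq_of_ae_hasDerivAt hab (f := fun t => (inner ℝ (q t) (p a) : ℝ)) (c := 1)
    (absolutelyContinuousOnInterval_inner (h.ac_fst a b)
      ((LipschitzWith.const _).absolutelyContinuousOnInterval a b)) (by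
      filter_upwards [h.ae_deriv] with t ⟨v, w, hv, hw, hvT, hwK, he⟩ ht
      have h2 := hv.inner ℝ (hasDerivAt_const t (p a))
      have h3 : -w = 0 := hw.unique (hp.hasDerivAt ht)
      rw [neg_eq_zero.1 h3, inner_zero_left, add_zero,
        hp t (Ioo_subset_Icc_self ht) a ⟨le_rfl, hab⟩] at he
      rwa [inner_zero_right, zero_add, he] at h2)
  rw [inner_sub_left, h1, one_mul]

theorem sub_mem_normalCone_of_restsOn_fst (hab : a ≤ b) (hq : RestsOn q a b) :
    p a - p b ∈ normalCone K (q a) := by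
  intro y hy
  have h1 := le_of_ae_hasDerivAt_nonneg hab (f := fun t => (inner ℝ (p t) (y - q a) : ℝ))
    (absolutelyContinuousOnInterval_inner (h.ac_snd a b)
      ((LipschitzWith.const _).absolutelyContinuousOnInterval a b)) (by
      filter_upwards [h.ae_deriv] with t ⟨v, w, hv, hw, hvT, hwK, he⟩ ht
      refine ⟨_, hw.inner ℝ (hasDerivAt_const t (y - q a)), ?_⟩
      have h2 := hwK y hy
      rw [hq t (Ioo_subset_Icc_self ht) a ⟨le_rfl, hab⟩] at h2
      rw [inner_zero_right, zero_add, inner_neg_left]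
      linarith)
  rw [inner_sub_left]
  linarith

theorem inner_sub_of_restsOn_fst (hab : a ≤ b) (hq : RestsOn q a b) :
    (inner ℝ (p a - p b) (q a) : ℝ) = b - a := by
  have h1 := sub_eq_of_ae_hasDerivAt hab (f := fun t => (inner ℝ (p t) (q a) : ℝ)) (c := -1)
    (absolutelyContinuousOnInterval_inner (h.ac_snd a b)
      ((LipschitzWith.const _).absolutelyContinuousOnInterval a b)) (by
      filter_upwards [h.ae_deriv] with t ⟨v, w, hv, hw, hvT, hwK, he⟩ ht
      have h2 := hw.inner ℝ (hasDerivAt_const t (q a))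
      have h3 : v = 0 := hv.unique (hq.hasDerivAt ht)
      rw [h3, inner_zero_left, zero_add,
        hq t (Ioo_subset_Icc_self ht) a ⟨le_rfl, hab⟩] at he
      rwa [inner_zero_right, zero_add, inner_neg_left, he] at h2)
  rw [inner_sub_left]
  linarith

theorem not_restsOn_both (hab : a < b) (hq : RestsOn q a b) : ¬ RestsOn p a b := by
  intro hp
  have h1 := h.inner_sub_of_restsOn_snd hab.le hp
  rw [hq b ⟨hab.le, le_rfl⟩ a ⟨le_rfl, hab.le⟩, sub_self, inner_zero_left] at h1
  linarith

/-- If all normals of `K` met along `(a, b)` are orthogonal to the direction of `z`, then the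
function `⟨q - z, p - p₀⟩` is monotone; if it has the same value at both ends, then `q` can only
move while `p` is at `p₀`. -/
theorem ae_eq_or_hasDerivAt_zero (hTs : StrictConvex ℝ T) {z p₀ : E} (hp₀ : p₀ ∈ T)
    (hz : ∀ t ∈ Ioo a b, ∀ w ∈ normalCone K (q t), (inner ℝ w (q t - z) : ℝ) = 0)
    (heq : (inner ℝ (q a - z) (p a - p₀) : ℝ) = inner ℝ (q b - z) (p b - p₀)) :
    ∀ᵐ t : ℝ, t ∈ Ioo a b → p t = p₀ ∨ HasDerivAt q 0 t := by
  have hder : ∀ᵐ t : ℝ, t ∈ Ioo a b → ∃ v, HasDerivAt q v t ∧ v ∈ normalCone T (p t) ∧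
      HasDerivAt (fun t => (inner ℝ (q t - z) (p t - p₀) : ℝ)) (inner ℝ v (p t - p₀)) t := by
    filter_upwards [h.ae_deriv] with t ⟨v, w, hv, hw, hvT, hwK, he⟩ ht
    refine ⟨v, hv, hvT, ?_⟩
    -- The product rule gives a second term `⟨q - z, ṗ⟩`, which vanishes by `hz`.
    have h2 := (hv.sub_const z).inner ℝ (hw.sub_const p₀)
    rwa [inner_neg_right, real_inner_comm, hz t ht w hwK, neg_zero, zero_add] at h2
  have h0 := ae_deriv_eq_zero_of_nonneg (f := fun t => (inner ℝ (q t - z) (p t - p₀) : ℝ))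
    (absolutelyContinuousOnInterval_inner
      ((h.ac_fst a b).sub ((LipschitzWith.const z).absolutelyContinuousOnInterval a b))
      ((h.ac_snd a b).sub ((LipschitzWith.const p₀).absolutelyContinuousOnInterval a b)))
    (by
      filter_upwards [hder] with t ht hmem
      obtain ⟨v, -, hvT, hd⟩ := ht hmem
      refine ⟨_, hd, ?_⟩
      have := hvT p₀ hp₀
      rw [← neg_sub, inner_neg_right] at this
      linarith) heq
  filter_upwards [hder] with t ht hmem
  obtain ⟨v, hv, hvT, hd⟩ := ht hmem
  have h1 := h0 t hmem _ hd
  by_cases hv0 : v = 0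
  · exact Or.inr (hv0 ▸ hv)
  · refine Or.inl (eq_of_inner_sub_eq_zero hTs (h.mem_snd t) hp₀ hvT hv0 ?_).symm
    rw [← neg_sub, inner_neg_right, h1, neg_zero]

/-- `p` cannot be at both points at once, so `q̇ = 0` almost everywhere. -/
theorem restsOn_fst_of_ne {p₁ p₂ : E} (hab : a ≤ b) (hne : p₁ ≠ p₂)
    (h₁ : ∀ᵐ t : ℝ, t ∈ Ioo a b → p t = p₁ ∨ HasDerivAt q 0 t)
    (h₂ : ∀ᵐ t : ℝ, t ∈ Ioo a b → p t = p₂ ∨ HasDerivAt q 0 t) : RestsOn q a b := by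
  obtain ⟨c, hc⟩ := (h.ac_fst a b).const_of_ae_hasDerivAt_zero (by
    have ha : ∀ᵐ t : ℝ, t ≠ a := by simp [ae_iff]
    have hb : ∀ᵐ t : ℝ, t ≠ b := by simp [ae_iff]
    filter_upwards [h₁, h₂, ha, hb] with t h1 h2 hta htb ht
    rw [uIcc_of_le hab] at ht
    have ht' : t ∈ Ioo a b := ⟨lt_of_le_of_ne ht.1 hta.symm, lt_of_le_of_ne ht.2 htb⟩
    rcases h1 ht' with h1 | h1
    · rcases h2 ht' with h2 | h2
      · exact absurd (h1.symm.trans h2) hne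
      · exact h2
    · exact h1)
  rw [uIcc_of_le hab] at hc
  exact fun s hs t ht => (hc s hs).trans (hc t ht).symm

theorem exists_forall_inner_sub_eq_zero (hK : IsConvexPolytope K) (t₀ : ℝ) : ∃ δ > 0,
    ∀ t, |t - t₀| < δ → ∀ w ∈ normalCone K (q t), (inner ℝ w (q t - q t₀) : ℝ) = 0 := by
  have h1 := (h.continuous_fst.tendsto t₀).eventually (hK.eventually_inner_sub_eq_zero (q t₀))
  obtain ⟨δ, hδ, H⟩ := Metric.eventually_nhds_iff.1 h1
  exact ⟨δ, hδ, fun t ht => H ht (h.mem_fst t)⟩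

/-- For `s` shortly before `t₀`, the product `⟨q - q t₀, p - p s⟩` vanishes at `s` through its
second factor and at `t₀` through its first. So between these times `q` moves only while `p` is at
`p s`. If `p s ≠ p s'`, this makes `q` rest from the later of the two times up to `t₀`. -/
theorem exists_restsOn_left (hK : IsConvexPolytope K) (hTs : StrictConvex ℝ T) (t₀ : ℝ) :
    ∃ δ > 0, RestsOn q (t₀ - δ) t₀ ∨ RestsOn p (t₀ - δ) t₀ := by
  obtain ⟨δ, hδ, H⟩ := h.exists_forall_inner_sub_eq_zero hK t₀
  by_cases hq : ∃ s < t₀, RestsOn q s t₀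
  · obtain ⟨s, hs, hq⟩ := hq
    exact ⟨t₀ - s, by linarith, Or.inl (by rwa [sub_sub_cancel])⟩
  refine ⟨δ, hδ, Or.inr (restsOn_of_Ico h.continuous_snd (by linarith) fun s hs s' hs' => ?_)⟩
  by_contra hne
  have key : ∀ s ∈ Ico (t₀ - δ) t₀, ∀ᵐ t : ℝ, t ∈ Ioo s t₀ → p t = p s ∨ HasDerivAt q 0 t :=
    fun s hs => h.ae_eq_or_hasDerivAt_zero hTs (h.mem_snd s) (z := q t₀)
      (fun t ht w hw => H t (by rw [abs_lt]; constructor <;> linarith [hs.1, ht.1, ht.2]) w hw)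
      (by simp)
  refine hq ⟨max s s', max_lt hs.2 hs'.2, h.restsOn_fst_of_ne (max_lt hs.2 hs'.2).le hne ?_ ?_⟩
  · filter_upwards [key s hs] with t ht hmem using ht (Ioo_subset_Ioo_left (le_max_left _ _) hmem)
  · filter_upwards [key s' hs'] with t ht hmem
      using ht (Ioo_subset_Ioo_left (le_max_right _ _) hmem)

theorem exists_restsOn_right (hK : IsConvexPolytope K) (hTs : StrictConvex ℝ T) (t₀ : ℝ) :
    ∃ δ > 0, RestsOn q t₀ (t₀ + δ) ∨ RestsOn p t₀ (t₀ + δ) := by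
  obtain ⟨δ, hδ, H⟩ := h.exists_forall_inner_sub_eq_zero hK t₀
  by_cases hq : ∃ s > t₀, RestsOn q t₀ s
  · obtain ⟨s, hs, hq⟩ := hq
    exact ⟨s - t₀, by linarith, Or.inl (by rwa [add_sub_cancel])⟩
  refine ⟨δ, hδ, Or.inr (restsOn_of_Ioc h.continuous_snd (by linarith) fun s hs s' hs' => ?_)⟩
  by_contra hne
  have key : ∀ s ∈ Ioc t₀ (t₀ + δ), ∀ᵐ t : ℝ, t ∈ Ioo t₀ s → p t = p s ∨ HasDerivAt q 0 t :=
    fun s hs => h.ae_eq_or_hasDerivAt_zero hTs (h.mem_snd s) (z := q t₀)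
      (fun t ht w hw => H t (by rw [abs_lt]; constructor <;> linarith [hs.2, ht.1, ht.2]) w hw)
      (by simp)
  refine hq ⟨min s s', lt_min hs.1 hs'.1, h.restsOn_fst_of_ne (lt_min hs.1 hs'.1).le hne ?_ ?_⟩
  · filter_upwards [key s hs] with t ht hmem using ht (Ioo_subset_Ioo_right (min_le_left _ _) hmem)
  · filter_upwards [key s' hs'] with t ht hmem
      using ht (Ioo_subset_Ioo_right (min_le_right _ _) hmem)

end IsNormalFlow

end

/-! ### Alternation of two periodic curves that rest in turn -/

section alternation

variable {E : Type*} {f : Bool → ℝ → E} {τ : ℝ}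

/-- `b` is the first time after `a` at which `f c` stops resting, and at which the other curve
starts to rest. -/
def IsSwitch (f : Bool → ℝ → E) (c : Bool) (a b : ℝ) : Prop :=
  a < b ∧ RestsOn (f c) a b ∧ ∃ δ > 0, RestsOn (f !c) b (b + δ)

theorem color_eq (hne : ∀ c a b, a < b → RestsOn (f c) a b → ¬ RestsOn (f !c) a b) {c d : Bool}
    {a b : ℝ} (hab : a < b) (hc : RestsOn (f c) a b) (hd : RestsOn (f d) a b) : c = d := by
  by_contra hcd
  have : d = !c := Bool.eq_not.2 (Ne.symm hcd)
  exact hne c a b hab hc (this ▸ hd)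

/-- If one switching time came earlier, both curves would rest just after it. Uniqueness is what
makes the switching times periodic. -/
theorem IsSwitch.unique (hne : ∀ c a b, a < b → RestsOn (f c) a b → ¬ RestsOn (f !c) a b)
    {c : Bool} {a b b' : ℝ} (h : IsSwitch f c a b) (h' : IsSwitch f c a b') : b = b' := by
  have key : ∀ {b b'}, IsSwitch f c a b → IsSwitch f c a b' → ¬ b < b' := by
    rintro b b' ⟨h1, h2, δ, hδ, h3⟩ ⟨h4, h5, -⟩ hlt
    have hlt' : b < min b' (b + δ) := lt_min hlt (by linarith)
    exact hne c b _ hlt' (h5.mono h1.le (min_le_left _ _)) (h3.mono le_rfl (min_le_right _ _))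
  exact le_antisymm (not_lt.1 (key h' h)) (not_lt.1 (key h h'))

theorem IsSwitch.add_period (hper : ∀ c, Function.Periodic (f c) τ) {c : Bool} {a b : ℝ}
    (h : IsSwitch f c a b) : IsSwitch f c (a + τ) (b + τ) := by
  obtain ⟨h1, h2, δ, hδ, h3⟩ := h
  refine ⟨by linarith, (RestsOn.add_period (hper c)).2 h2, δ, hδ, ?_⟩
  rw [add_right_comm]
  exact (RestsOn.add_period (hper _)).2 h3

variable [NormedAddCommGroup E]

/-- Take the supremum of the times up to which `f c` rests, finite because no curve rests for a
whole period. The curve resting just after it cannot be `f c`, whose rest would then continue. -/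
theorem exists_isSwitch (hcont : ∀ c, Continuous (f c))
    (hright : ∀ t, ∃ δ > 0, ∃ c, RestsOn (f c) t (t + δ))
    (hmove : ∀ c a, ¬ RestsOn (f c) a (a + τ)) {c : Bool} {a δ : ℝ} (hδ : 0 < δ)
    (h : RestsOn (f c) a (a + δ)) : ∃ b, IsSwitch f c a b := by
  set S : Set ℝ := {s | a ≤ s ∧ RestsOn (f c) a s} with hS
  have hbdd : ∀ s ∈ S, s ≤ a + τ := by
    rintro s ⟨-, hs⟩
    by_contra! hlt
    exact hmove c a (hs.mono le_rfl hlt.le)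
  have hbdd' : BddAbove S := ⟨a + τ, hbdd⟩
  have hδS : a + δ ∈ S := ⟨by linarith, h⟩
  have hne : S.Nonempty := ⟨_, hδS⟩
  set b := sSup S with hb
  have hab : a < b := lt_of_lt_of_le (by linarith) (le_csSup hbdd' hδS)
  have hrest : RestsOn (f c) a b := by
    refine restsOn_of_Ico (hcont c) hab fun s hs t ht => ?_
    obtain ⟨u, hu, hlt⟩ := exists_lt_of_lt_csSup hne (max_lt hs.2 ht.2)
    exact hu.2 s ⟨hs.1, (le_max_left _ _).trans hlt.le⟩ t ⟨ht.1, (le_max_right _ _).trans hlt.le⟩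
  obtain ⟨ε, hε, d, hd⟩ := hright b
  refine ⟨b, hab, hrest, ε, hε, ?_⟩
  have hdc : d ≠ c := by
    rintro rfl
    have : b + ε ≤ b := le_csSup hbdd' ⟨by linarith, hrest.trans hd⟩
    linarith
  have : d = !c := Bool.eq_not.2 hdc
  exact this ▸ hd

/-- Two periodic curves of which at every moment exactly one is locally at rest, both to the left
and to the right, come to rest alternately, on finitely many intervals per period. -/
theorem exists_alternation (hτ : 0 < τ) (hcont : ∀ c, Continuous (f c))
    (hper : ∀ c, Function.Periodic (f c) τ)
    (hne : ∀ c a b, a < b → RestsOn (f c) a b → ¬ RestsOn (f !c) a b)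
    (hleft : ∀ t, ∃ δ > 0, ∃ c, RestsOn (f c) (t - δ) t)
    (hright : ∀ t, ∃ δ > 0, ∃ c, RestsOn (f c) t (t + δ))
    (hmove : ∀ c a, ¬ RestsOn (f c) a (a + τ)) :
    ∃ (t : ℕ → ℝ) (m : ℕ), (∀ k, t k < t (k + 1)) ∧ 0 < m ∧ (∀ k, t (k + 2 * m) = t k + τ) ∧
      (∀ j, RestsOn (f true) (t (2 * j)) (t (2 * j + 1))) ∧
      ∀ j, RestsOn (f false) (t (2 * j + 1)) (t (2 * j + 2)) := by
  have hex : ∀ c a, ∃ b, (∃ δ > 0, RestsOn (f c) a (a + δ)) → IsSwitch f c a b := by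
    intro c a
    by_cases h : ∃ δ > 0, RestsOn (f c) a (a + δ)
    · obtain ⟨δ, hδ, h⟩ := h
      obtain ⟨b, hb⟩ := exists_isSwitch hcont hright hmove hδ h
      exact ⟨b, fun _ => hb⟩
    -- A default value, never used: `next` is applied only where a rest begins.
    · exact ⟨a, fun h' => absurd h' h⟩
  choose next hnext using hex
  -- The starting time must be a genuine switch from `f false` to `f true`, so that its translate
  -- `t₀ + τ` is recognizable as a switch too.
  obtain ⟨t₀, ⟨δ, hδ, hl⟩, hr⟩ : ∃ t₀, (∃ δ > 0, RestsOn (f false) (t₀ - δ) t₀) ∧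
      ∃ δ > 0, RestsOn (f true) t₀ (t₀ + δ) := by
    have key : ∀ a, (∃ δ > 0, RestsOn (f false) a (a + δ)) →
        ∃ t₀, (∃ δ > 0, RestsOn (f false) (t₀ - δ) t₀) ∧
          ∃ δ > 0, RestsOn (f true) t₀ (t₀ + δ) := by
      intro a ha
      obtain ⟨h1, h2, h3⟩ := hnext false a ha
      exact ⟨next false a, ⟨next false a - a, by linarith, by rwa [sub_sub_cancel]⟩, h3⟩
    obtain ⟨ε, hε, c, hc⟩ := hright 0
    cases c with
    | false => exact key 0 ⟨ε, hε, hc⟩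
    | true => exact key _ (hnext true 0 ⟨ε, hε, hc⟩).2.2
  set col : ℕ → Bool := fun k => decide (k % 2 = 0) with hcol
  have hcol1 : ∀ k, col (k + 1) = !col k := by
    intro k
    simp only [hcol]
    rcases Nat.mod_two_eq_zero_or_one k with h | h <;> simp [Nat.add_mod, h]
  set t : ℕ → ℝ := fun n => Nat.rec t₀ (fun k s => next (col k) s) n with ht
  have ht0 : t 0 = t₀ := rfl
  have ht1 : ∀ k, t (k + 1) = next (col k) (t k) := fun k => rfl
  have hstart : ∀ k, ∃ δ > 0, RestsOn (f (col k)) (t k) (t k + δ) := by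
    intro k
    induction k with
    | zero => exact hr
    | succ k ih =>
      rw [hcol1, ht1]
      exact (hnext _ _ ih).2.2
  have hsw : ∀ k, IsSwitch f (col k) (t k) (t (k + 1)) := fun k => hnext _ _ (hstart k)
  have hlt : ∀ k, t k < t (k + 1) := fun k => (hsw k).1
  have hmono : StrictMono t := strictMono_nat_of_lt_succ hlt
  -- If the switching times accumulated, the curve resting just to the left of their supremum would
  -- share intervals with rests of both colours.
  have hunb : ∀ B, ∃ n, B < t n := by
    by_contra! hB
    obtain ⟨B, hB⟩ := hB
    have hbdd : BddAbove (range t) := ⟨B, by rintro _ ⟨n, rfl⟩; exact hB n⟩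
    obtain ⟨ε, hε, c, hc⟩ := hleft (sSup (range t))
    obtain ⟨_, ⟨k, rfl⟩, hk⟩ := exists_lt_of_lt_csSup (range_nonempty t)
      (show sSup (range t) - ε < sSup (range t) by linarith)
    have key : ∀ i, k ≤ i → c = col i := by
      intro i hi
      refine color_eq hne (hlt i) (hc.mono ?_ ?_) (hsw i).2.1
      · exact hk.le.trans (hmono.monotone hi)
      · exact le_csSup hbdd ⟨i + 1, rfl⟩
    have h1 := key k le_rfl
    have h2 := key (k + 1) (by omega)
    rw [hcol1, ← h1] at h2
    cases c <;> simp at h2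
  obtain ⟨k, hk1, hk2⟩ : ∃ k, t k ≤ t₀ + τ ∧ t₀ + τ < t (k + 1) := by
    classical
    have hn := Nat.find_spec (hunb (t₀ + τ))
    have hmin := fun i => Nat.find_min (hunb (t₀ + τ)) (m := i)
    set n := Nat.find (hunb (t₀ + τ))
    obtain ⟨k, hk⟩ : ∃ k, n = k + 1 := by
      refine Nat.exists_eq_succ_of_ne_zero fun h => ?_
      rw [h, ht0] at hn
      linarith
    exact ⟨k, not_lt.1 (hmin k (by omega)), hk ▸ hn⟩
  obtain ⟨ε, hε, hr⟩ := hr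
  -- By periodicity `f true` rests just after `t₀ + τ`, inside the `k`-th interval.
  have hcolk : col k = true := by
    have h1 : t₀ + τ < min (t (k + 1)) (t₀ + ε + τ) := lt_min hk2 (by linarith)
    refine color_eq hne h1 ((hsw k).2.1.mono hk1 (min_le_left _ _)) ?_
    exact ((RestsOn.add_period (hper true)).2 hr).mono le_rfl (min_le_right _ _)
  -- Otherwise the `k`-th rest, of `f true`, would begin before `t₀ + τ` and overlap the translated
  -- rest of `f false` that ends there.
  have htk : t k = t₀ + τ := by
    by_contra hne'
    have h1 : max (t k) (t₀ - δ + τ) < t₀ + τ := max_lt (lt_of_le_of_ne hk1 hne') (by linarith)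
    have h2 := color_eq hne h1 ((hsw k).2.1.mono (le_max_left _ _) hk2.le)
      (((RestsOn.add_period (hper false)).2 hl).mono (le_max_right _ _) le_rfl)
    rw [hcolk] at h2
    cases h2
  obtain ⟨m, hm⟩ : ∃ m, k = 2 * m := ⟨k / 2, by
    have : k % 2 = 0 := by simpa [hcol] using hcolk
    omega⟩
  subst hm
  have heven : ∀ j, col (2 * j) = true := fun j => by simp [hcol]
  refine ⟨t, m, hlt, ?_, ?_, ?_, ?_⟩
  · rcases Nat.eq_zero_or_pos m with rfl | h
    · rw [mul_zero, ht0] at htk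
      linarith
    · exact h
  · intro k
    induction k with
    | zero => rw [zero_add, htk, ht0]
    | succ k ih =>
      have h1 := hsw (k + 2 * m)
      have h2 : col (k + 2 * m) = col k := by simp [hcol]
      rw [h2, ih, add_right_comm] at h1
      exact h1.unique hne ((hsw k).add_period hper)
  · intro j
    have := (hsw (2 * j)).2.1
    rwa [heven] at this
  · intro j
    have := (hsw (2 * j + 1)).2.1
    rwa [hcol1, heven] at this

end alternation

/-! ### From closed characteristics to billiard trajectories -/

section

variable {E : Type*} [NormedAddCommGroup E] [InnerProductSpace ℝ E] {K T : Set E} {m : ℕ}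
  {q p : ℕ → E}

/-- The normality conditions of a closed billiard trajectory and its dual, without any
nondegeneracy of the polygons. -/
structure IsWeakPair (K T : Set E) (m : ℕ) (q p : ℕ → E) : Prop where
  periodic : Function.Periodic q m
  periodic_dual : Function.Periodic p m
  mem : ∀ j, q j ∈ K
  dual_mem : ∀ j, p j ∈ T
  sub_mem : ∀ j, q (j + 1) - q j ∈ normalCone T (p j)
  dual_sub_mem : ∀ j, -(p (j + 1) - p j) ∈ normalCone K (q (j + 1))

theorem IsBilliardPair.isWeakPair (hK : IsConvexBody K) (hT : IsConvexBody T)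
    (h : IsBilliardPair K T m q p) : IsWeakPair K T m q p :=
  ⟨h.polygon.periodic, h.periodic_dual,
    fun j => hK.isCompact.isClosed.frontier_subset (h.mem_frontier j),
    fun j => hT.isCompact.isClosed.frontier_subset (h.dual_mem_frontier j), h.sub_mem,
    h.dual_sub_mem⟩

/-- Summation by parts around the cycle. It says that the motion of `p` takes as much time in total
as the motion of `q`. -/
theorem sum_inner_sub_eq (hq : Function.Periodic q m) (hp : Function.Periodic p m) :
    ∑ j ∈ Finset.range m, (inner ℝ (p j - p (j + 1)) (q (j + 1)) : ℝ) =
      ∑ j ∈ Finset.range m, inner ℝ (q (j + 1) - q j) (p j) := by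
  have h1 : ∀ j, (inner ℝ (p j - p (j + 1)) (q (j + 1)) : ℝ) =
      inner ℝ (q (j + 1) - q j) (p j) +
        (inner ℝ (q j) (p j) - inner ℝ (q (j + 1)) (p (j + 1))) := by
    intro j
    rw [inner_sub_left, inner_sub_left, real_inner_comm (q (j + 1)) (p j),
      real_inner_comm (q (j + 1)) (p (j + 1))]
    ring
  simp only [h1, Finset.sum_add_distrib]
  rw [Finset.sum_range_sub' (fun j => (inner ℝ (q j) (p j) : ℝ)), hq.eq, hp.eq]
  simp

theorem IsWeakPair.ellLength_eq (hT : IsConvexBody T) (h : IsWeakPair K T m q p) :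
    ellLength T m q = ∑ j ∈ Finset.range m, inner ℝ (q (j + 1) - q j) (p j) :=
  Finset.sum_congr rfl fun j _ => gauge_polarBody hT (h.dual_mem j) (h.sub_mem j)

/-- Every closed characteristic on `∂(K × T)` runs along a closed billiard trajectory and its
dual. -/
theorem IsClosedCharacteristic.exists_isBilliardPair {τ : ℝ} {x : ℝ → E × E}
    (hK : IsConvexPolytope K) (hT : IsConvexBody T) (hTs : StrictConvex ℝ T)
    (hx : IsClosedCharacteristic (K ×ˢ T) τ x) :
    ∃ m q p, IsBilliardPair K T m q p ∧ (∀ j, p j ≠ p (j + 1)) ∧ HasChangingPoints τ x m q p ∧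
      τ = 2 * ellLength T m q := by
  have hf := hx.isNormalFlow hK.isConvexBody hT
  set u : ℝ → E := fun t => (x t).1 with hu
  set w : ℝ → E := fun t => (x t).2 with hw
  have hup : Function.Periodic u τ := fun t => by simp only [hu, hx.periodic t]
  have hwp : Function.Periodic w τ := fun t => by simp only [hw, hx.periodic t]
  have hτ := hx.period_pos
  obtain ⟨t, m, hlt, hm, htm, htrue, hfalse⟩ :=
    -- Colour `true` stands for `p` at rest, so the even intervals are those on which `q` moves.
    exists_alternation (f := fun c => cond c w u) hτ
      (by rintro (_ | _); exacts [hf.continuous_fst, hf.continuous_snd])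
      (by rintro (_ | _); exacts [hup, hwp])
      (by
        rintro (_ | _) a b hab h1 h2
        · exact hf.not_restsOn_both hab h1 h2
        · exact hf.not_restsOn_both hab h2 h1)
      (by
        intro s
        obtain ⟨δ, hδ, h | h⟩ := hf.exists_restsOn_left hK hTs s
        exacts [⟨δ, hδ, false, h⟩, ⟨δ, hδ, true, h⟩])
      (by
        intro s
        obtain ⟨δ, hδ, h | h⟩ := hf.exists_restsOn_right hK hTs s
        exacts [⟨δ, hδ, false, h⟩, ⟨δ, hδ, true, h⟩])
      (by
        -- A rest over a full period would equate the pairing of a zero displacement with `τ > 0`.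
        rintro (_ | _) a h
        · have := hf.inner_sub_of_restsOn_fst (by linarith) h
          rw [hwp a, sub_self, inner_zero_left] at this
          linarith
        · have := hf.inner_sub_of_restsOn_snd (by linarith) h
          rw [hup a, sub_self, inner_zero_left] at this
          linarith)
  simp only [cond_true, cond_false] at htrue hfalse
  set q : ℕ → E := fun j => u (t (2 * j)) with hq
  set p : ℕ → E := fun j => w (t (2 * j)) with hp
  have hp1 : ∀ j, w (t (2 * j + 1)) = p j := fun j =>
    htrue j _ ⟨(hlt _).le, le_rfl⟩ _ ⟨le_rfl, (hlt _).le⟩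
  have hq1 : ∀ j, u (t (2 * j + 1)) = q (j + 1) := fun j =>
    hfalse j _ ⟨le_rfl, (hlt _).le⟩ _ ⟨(hlt _).le, le_rfl⟩
  have hp2 : ∀ j, w (t (2 * j + 1 + 1)) = p (j + 1) := fun j => rfl
  have hd : ∀ j, (inner ℝ (q (j + 1) - q j) (p j) : ℝ) = t (2 * j + 1) - t (2 * j) := fun j => by
    have := hf.inner_sub_of_restsOn_snd (hlt _).le (htrue j)
    rwa [hq1] at this
  have hd' : ∀ j, (inner ℝ (p j - p (j + 1)) (q (j + 1)) : ℝ) =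
      t (2 * j + 2) - t (2 * j + 1) := fun j => by
    have := hf.inner_sub_of_restsOn_fst (hlt (2 * j + 1)).le (hfalse j)
    rwa [hq1, hp1, hp2] at this
  have hsub : ∀ j, q (j + 1) - q j ∈ normalCone T (p j) := fun j => by
    have := hf.sub_mem_normalCone_of_restsOn_snd (hlt _).le (htrue j)
    rwa [hq1] at this
  have hsub' : ∀ j, p j - p (j + 1) ∈ normalCone K (q (j + 1)) := fun j => by
    have := hf.sub_mem_normalCone_of_restsOn_fst (hlt (2 * j + 1)).le (hfalse j)
    rwa [hq1, hp1, hp2] at this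
  have hqne : ∀ j, q (j + 1) - q j ≠ 0 := fun j h => by
    have h1 := hd j
    rw [h, inner_zero_left] at h1
    linarith [hlt (2 * j)]
  have hpne : ∀ j, p j - p (j + 1) ≠ 0 := fun j h => by
    have h1 := hd' j
    rw [h, inner_zero_left] at h1
    linarith [hlt (2 * j + 1)]
  have hqm : Function.Periodic q m := fun j => by
    simp only [hq, mul_add]
    rw [htm, hup]
  have hpm : Function.Periodic p m := fun j => by
    simp only [hp, mul_add]
    rw [htm, hwp]
  have hqK : ∀ j, q j ∈ frontier K := by
    have key : ∀ j, q (j + 1) ∈ frontier K := fun j =>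
      mem_frontier_of_mem_normalCone (hf.mem_fst _) (hsub' j) (hpne j)
    -- The normal at a vertex comes from the preceding index, so `j` is first moved up by a period
    -- to be a successor.
    intro j
    rw [← hqm j]
    obtain ⟨i, hi⟩ : ∃ i, j + m = i + 1 := ⟨j + m - 1, by omega⟩
    rw [hi]
    exact key i
  have hpair : IsBilliardPair K T m q p := by
    refine ⟨⟨?_, hqm, fun j h => hqne j (sub_eq_zero.2 h.symm), ?_⟩, hpm, hqK,
      fun j => mem_frontier_of_mem_normalCone (hf.mem_snd _) (hsub j) (hqne j), hsub,
      fun j => by rw [neg_sub]; exact hsub' j⟩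
    · by_contra! h
      have : m = 1 := by omega
      subst this
      exact hqne 0 (sub_eq_zero.2 (hqm 0))
    -- If the path does not turn at `q (j + 1)`, the two sides there are positively parallel. Then
    -- `q (j + 1) - q j` is normal to `T` at both `p j` and `p (j + 1)`, and strict convexity makes
    -- these equal.
    · rintro j ⟨a, b, ha, hb, hab, h⟩
      have h1 : a • (q (j + 1) - q j) = b • (q (j + 2) - q (j + 1)) := by
        have : q (j + 1) = (a + b) • q (j + 1) := by rw [hab, one_smul]
        rw [smul_sub, smul_sub, sub_eq_sub_iff_add_eq_add, ← add_smul, hab, one_smul, ← h]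
        abel
      have ha0 : 0 < a := by
        refine lt_of_le_of_ne ha fun h0 => ?_
        rw [← h0, zero_smul, show b = 1 by linarith, one_smul] at h1
        exact hqne (j + 1) h1.symm
      have h2 : q (j + 1) - q j ∈ normalCone T (p (j + 1)) := by
        have h3 := smul_mem_normalCone (smul_mem_normalCone (hsub (j + 1)) hb)
          (inv_nonneg.2 ha0.le)
        rwa [← h1, inv_smul_smul₀ ha0.ne'] at h3
      have h3 := hsub j (p (j + 1)) (hf.mem_snd _)
      have h4 := h2 (p j) (hf.mem_snd _)
      rw [← neg_sub (p (j + 1)), inner_neg_right] at h4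
      refine hpne j (sub_eq_zero.2 (eq_of_inner_sub_eq_zero hTs (hf.mem_snd _) (hf.mem_snd _)
        (hsub j) (hqne j) (by linarith)).symm)
  refine ⟨m, q, p, hpair, fun j h => hpne j (sub_eq_zero.2 h),
    ⟨t, fun k _ => hlt k, by simpa using htm 0, fun j _ => ⟨rfl, ?_, rfl⟩, fun j _ s hs => ?_,
      fun j _ s hs => ?_⟩, ?_⟩
  · exact Prod.ext (hq1 j) (hp1 j)
  · exact htrue j s hs _ ⟨le_rfl, (hlt _).le⟩
  · exact (hfalse j s hs _ ⟨le_rfl, (hlt _).le⟩).trans (hq1 j)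
  · rw [(hpair.isWeakPair hK.isConvexBody hT).ellLength_eq hT, two_mul]
    nth_rewrite 2 [← sum_inner_sub_eq hqm hpm]
    rw [← Finset.sum_add_distrib]
    have h1 : ∀ j, (inner ℝ (q (j + 1) - q j) (p j) + inner ℝ (p j - p (j + 1)) (q (j + 1)) : ℝ) =
        t (2 * (j + 1)) - t (2 * j) := fun j => by
      rw [hd, hd', mul_add]
      ring
    simp only [h1]
    rw [Finset.sum_range_sub (fun j => t (2 * j))]
    have := htm 0
    simp only [zero_add] at this
    rw [this, mul_zero]
    ring

end

/-! ### Closed piecewise affine curves -/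

section interpolation

theorem exists_le_and_lt_succ {t : ℕ → ℝ} {N : ℕ} {u : ℝ} (h0 : t 0 ≤ u) (hN : u < t N) :
    ∃ k < N, t k ≤ u ∧ u < t (k + 1) := by
  induction N with
  | zero => exact absurd hN (not_lt.2 h0)
  | succ N ih =>
    rcases lt_or_ge u (t N) with h | h
    · obtain ⟨k, hk, hk'⟩ := ih h
      exact ⟨k, by omega, hk'⟩
    · exact ⟨N, by omega, h, hN⟩

variable {V : Type*} [NormedAddCommGroup V] [NormedSpace ℝ V] {X : ℕ → V} {t : ℕ → ℝ}

open AffineMap in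
/-- The piecewise affine curve through the points `X k` at the times `t k`. -/
theorem exists_piecewise_affine (ht : ∀ k, t k ≤ t (k + 1))
    (hX : ∀ k, t k = t (k + 1) → X k = X (k + 1)) (N : ℕ) :
    ∃ y : ℝ → V, (∃ L, LipschitzWith L y) ∧ y (t 0) = X 0 ∧ (∀ s, t N ≤ s → y s = X N) ∧
      ∀ k < N, ∀ s ∈ Icc (0 : ℝ) 1,
        y (lineMap (t k) (t (k + 1)) s) = lineMap (X k) (X (k + 1)) s := by
  have hmono : Monotone t := monotone_nat_of_le_succ ht
  induction N with
  | zero => exact ⟨fun _ => X 0, ⟨0, LipschitzWith.const _⟩, rfl, fun _ _ => rfl, by simp⟩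
  | succ N ih =>
    obtain ⟨y, ⟨L, hL⟩, h0, hlast, hy⟩ := ih
    set d := t (N + 1) - t N with hd
    have hd0 : 0 ≤ d := sub_nonneg.2 (ht N)
    -- A ramp from `0` to `1` across the last interval. For `d = 0` the convention `d⁻¹ = 0` makes
    -- it vanish, which is correct because then `X N = X (N + 1)`.
    set c : ℝ → ℝ := fun s => max 0 (min 1 (d⁻¹ * (s - t N))) with hc
    have hc0 : ∀ s ≤ t N, c s = 0 := fun s hs => by
      have : d⁻¹ * (s - t N) ≤ 0 :=
        mul_nonpos_of_nonneg_of_nonpos (inv_nonneg.2 hd0) (by linarith)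
      exact max_eq_left ((min_le_right _ _).trans this)
    have hcL : ∃ L', LipschitzWith L' c := by
      have h1 : LipschitzWith ⟨d⁻¹, inv_nonneg.2 hd0⟩ fun s => d⁻¹ * (s - t N) := by
        refine LipschitzWith.of_dist_le_mul fun a b => ?_
        rw [Real.dist_eq, Real.dist_eq, ← mul_sub, sub_sub_sub_cancel_right, abs_mul,
          abs_of_nonneg (inv_nonneg.2 hd0)]
        rfl
      exact ⟨_, (h1.const_min 1).const_max 0⟩
    obtain ⟨L', hcL⟩ := hcL
    refine ⟨fun s => y s + c s • (X (N + 1) - X N),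
      ⟨_, hL.add ((ContinuousLinearMap.toSpanSingleton ℝ (X (N + 1) - X N)).lipschitz.comp hcL)⟩,
      ?_, fun s hs => ?_, fun k hk s hs => ?_⟩
    · simp only [hc0 _ (hmono (Nat.zero_le N)), h0, zero_smul, add_zero]
    · simp only [hlast s ((ht N).trans hs)]
      rcases hd0.eq_or_lt with h | h
      · rw [hX N (by linarith)]
        simp
      · have : 1 ≤ d⁻¹ * (s - t N) := by
          rw [inv_mul_eq_div, le_div_iff₀ h]
          linarith
        simp only [hc, min_eq_left this, max_eq_right zero_le_one, one_smul, add_sub_cancel]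
    · have hle : lineMap (t k) (t (k + 1)) s ≤ t (k + 1) ∧
          t k ≤ lineMap (t k) (t (k + 1)) s := by
        rw [lineMap_apply_ring']
        constructor <;> nlinarith [ht k, hs.1, hs.2]
      rcases Nat.lt_succ_iff_lt_or_eq.1 hk with hk | rfl
      · simp only [hc0 _ (hle.1.trans (hmono hk)), hy k hk s hs, zero_smul, add_zero]
      · simp only [hlast _ hle.2]
        rcases hd0.eq_or_lt with h | h
        · rw [hX k (by linarith)]
          simp
        · have h1 : d⁻¹ * (lineMap (t k) (t (k + 1)) s - t k) = s := by
            rw [lineMap_apply_ring', ← hd]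
            field_simp
            ring
          simp only [hc, h1, min_eq_right hs.2, max_eq_right hs.1]
          rw [lineMap_apply_module', add_comm]

open AffineMap in
/-- The closed piecewise affine curve through the points `X k` at the times `t k`, as a periodic
curve. -/
theorem exists_periodic_piecewise_affine {N : ℕ} {τ : ℝ} (ht : ∀ k, t k ≤ t (k + 1))
    (hX : ∀ k, t k = t (k + 1) → X k = X (k + 1)) (ht0 : t 0 = 0) (htN : t N = τ) (hτ : 0 < τ)
    (hXN : X N = X 0) :
    ∃ x : ℝ → V, Function.Periodic x τ ∧ AbsolutelyContinuousOnInterval x 0 τ ∧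
      (∀ k < N, ∀ s ∈ Icc (0 : ℝ) 1,
        x (lineMap (t k) (t (k + 1)) s) = lineMap (X k) (X (k + 1)) s) ∧
      (∀ u, ∃ k < N, t k < t (k + 1) ∧
        ∃ s ∈ Icc (0 : ℝ) 1, x u = lineMap (X k) (X (k + 1)) s) ∧
      ∀ᵐ u : ℝ, ∃ k < N, t k < t (k + 1) ∧
        (∃ s ∈ Icc (0 : ℝ) 1, x u = lineMap (X k) (X (k + 1)) s) ∧
        HasDerivAt x ((t (k + 1) - t k)⁻¹ • (X (k + 1) - X k)) u := by
  have hmono : Monotone t := monotone_nat_of_le_succ ht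
  obtain ⟨y, ⟨L, hL⟩, hy0, hylast, hy⟩ := exists_piecewise_affine ht hX N
  set x : ℝ → V := fun u => y (toIcoMod hτ 0 u) with hx
  have hper : Function.Periodic x τ := fun u => by simp only [hx, toIcoMod_add_right]
  have hxy : ∀ u ∈ Icc 0 τ, x u = y u := by
    intro u hu
    rcases hu.2.eq_or_lt with rfl | hlt
    · rw [← zero_add u, hper 0, zero_add, hylast u htN.le, hXN, ← hy0, ht0]
      simp only [hx, toIcoMod_apply_left]
    · simp only [hx]
      rw [(toIcoMod_eq_self hτ).2 ⟨hu.1, by simpa using hlt⟩]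
  have hline : ∀ k < N, ∀ s ∈ Icc (0 : ℝ) 1,
      x (lineMap (t k) (t (k + 1)) s) = lineMap (X k) (X (k + 1)) s := by
    intro k hk s hs
    rw [hxy, hy k hk s hs]
    have h0 := hmono (Nat.zero_le k)
    have h1 := hmono (show k + 1 ≤ N from hk)
    rw [lineMap_apply_ring']
    constructor <;> nlinarith [ht k, hs.1, hs.2]
  have hform : ∀ k < N, t k < t (k + 1) → ∀ u ∈ Icc (t k) (t (k + 1)),
      (t (k + 1) - t k)⁻¹ * (u - t k) ∈ Icc (0 : ℝ) 1 ∧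
      x u = lineMap (X k) (X (k + 1)) ((t (k + 1) - t k)⁻¹ * (u - t k)) := by
    intro k hk hlt u hu
    have hd : 0 < t (k + 1) - t k := sub_pos.2 hlt
    have hmem : (t (k + 1) - t k)⁻¹ * (u - t k) ∈ Icc (0 : ℝ) 1 := by
      constructor
      · exact mul_nonneg (inv_nonneg.2 hd.le) (by linarith [hu.1])
      · rw [inv_mul_eq_div, div_le_one hd]
        linarith [hu.2]
    refine ⟨hmem, ?_⟩
    rw [← hline k hk _ hmem, lineMap_apply_ring']
    congr 1
    field_simp
    ring
  have hex : ∀ u, ∃ k < N, t k ≤ toIcoMod hτ 0 u ∧ toIcoMod hτ 0 u < t (k + 1) := by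
    intro u
    have := toIcoMod_mem_Ico hτ 0 u
    exact exists_le_and_lt_succ (ht0 ▸ this.1) (by rw [htN]; simpa using this.2)
  have hmod : ∀ u, x u = x (toIcoMod hτ 0 u) := by
    intro u
    have := toIcoMod_mem_Ico hτ 0 u
    rw [hxy _ ⟨this.1, by simpa using this.2.le⟩]
  refine ⟨x, hper, ?_, hline, fun u => ?_, ?_⟩
  · refine LipschitzOnWith.absolutelyContinuousOnInterval (K := L) fun a ha b hb => ?_
    rw [uIcc_of_le hτ.le] at ha hb
    rw [hxy a ha, hxy b hb]
    exact hL a b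
  · obtain ⟨k, hk, h1, h2⟩ := hex u
    obtain ⟨h3, h4⟩ := hform k hk (h1.trans_lt h2) _ ⟨h1, h2.le⟩
    exact ⟨k, hk, h1.trans_lt h2, _, h3, (hmod u).trans h4⟩
  -- The break times and their translates by periods are countably many; at all other times the
  -- curve is locally affine.
  · have hcount : (⋃ k : ℕ, range fun z : ℤ => t k + z • τ).Countable :=
      countable_iUnion fun k => countable_range _
    filter_upwards [hcount.ae_notMem volume] with u hu
    obtain ⟨k, hk, h1, h2⟩ := hex u
    have hu1 : toIcoMod hτ 0 u = u - toIcoDiv hτ 0 u • τ := rfl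
    have h1' : t k < toIcoMod hτ 0 u := by
      refine lt_of_le_of_ne h1 fun h => hu (mem_iUnion.2 ⟨k, toIcoDiv hτ 0 u, ?_⟩)
      simp only [h, hu1, sub_add_cancel]
    obtain ⟨h3, h4⟩ := hform k hk (h1.trans_lt h2) _ ⟨h1, h2.le⟩
    refine ⟨k, hk, h1.trans_lt h2, ⟨_, h3, (hmod u).trans h4⟩, ?_⟩
    set z := toIcoDiv hτ 0 u
    have h5 : HasDerivAt
        (fun v : ℝ => lineMap (X k) (X (k + 1)) ((t (k + 1) - t k)⁻¹ * (v - z • τ - t k)))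
        ((t (k + 1) - t k)⁻¹ • (X (k + 1) - X k)) u := by
      simp only [lineMap_apply_module']
      have := ((((hasDerivAt_id u).sub_const (z • τ)).sub_const (t k)).const_mul
        (t (k + 1) - t k)⁻¹).smul_const (X (k + 1) - X k)
      simpa using this.add_const (X k)
    refine h5.congr_of_eventuallyEq ?_
    have h6 : ∀ᶠ v in nhds u, v - z • τ ∈ Ioo (t k) (t (k + 1)) :=
      ((continuous_id.sub continuous_const).tendsto u).eventually (Ioo_mem_nhds h1' h2)
    filter_upwards [h6] with v hv
    rw [← (hform k hk (h1.trans_lt h2) _ (Ioo_subset_Icc_self hv)).2, hper.sub_zsmul_eq]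

end interpolation

/-! ### From billiard trajectories to closed characteristics -/

section

variable {E : Type*} [NormedAddCommGroup E] [InnerProductSpace ℝ E] {K T : Set E} {m : ℕ}
  {q p : ℕ → E}

theorem mem_frontier_of_inner_pos {z v : E} (hz : z ∈ K) (hv : v ∈ normalCone K z)
    (h : 0 < (inner ℝ v z : ℝ)) : z ∈ frontier K :=
  mem_frontier_of_mem_normalCone hz hv fun h0 => by simp [h0] at h

/-- The polygon through a weak billiard pair is parametrized by a closed characteristic. -/
theorem IsWeakPair.exists_isClosedCharacteristic (hK : IsConvexBody K) (hT : IsConvexBody T)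
    (h : IsWeakPair K T m q p) (hpos : 0 < ellLength T m q) :
    ∃ x, IsClosedCharacteristic (K ×ˢ T) (2 * ellLength T m q) x ∧
      IsPolygonalLoop (2 * ellLength T m q) x m q p := by
  have hsub : ∀ j, p j - p (j + 1) ∈ normalCone K (q (j + 1)) := fun j => by
    have := h.dual_sub_mem j
    rwa [neg_sub] at this
  set X : ℕ → E × E := fun k => (q ((k + 1) / 2), p (k / 2)) with hXdef
  -- The durations are forced by the normalization of the flow on each segment.
  set d : ℕ → ℝ := fun k => if k % 2 = 0 then inner ℝ (q (k / 2 + 1) - q (k / 2)) (p (k / 2))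
    else inner ℝ (p (k / 2) - p (k / 2 + 1)) (q (k / 2 + 1)) with hddef
  have hX0 : ∀ j, X (2 * j) = (q j, p j) := fun j => by
    simp only [hXdef]
    congr 2 <;> omega
  have hX1 : ∀ j, X (2 * j + 1) = (q (j + 1), p j) := fun j => by
    simp only [hXdef]
    congr 2 <;> omega
  have hX2 : ∀ j, X (2 * j + 1 + 1) = (q (j + 1), p (j + 1)) := fun j => hX0 (j + 1)
  have hd0 : ∀ j, d (2 * j) = inner ℝ (q (j + 1) - q j) (p j) := fun j => by
    simp [hddef]
  have hd1 : ∀ j, d (2 * j + 1) = inner ℝ (p j - p (j + 1)) (q (j + 1)) := fun j => by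
    have : (2 * j + 1) / 2 = j := by omega
    simp [hddef, this, Nat.add_mod]
  have hpar : ∀ k, ∃ j, k = 2 * j ∨ k = 2 * j + 1 := fun k => ⟨k / 2, by omega⟩
  have hdnn : ∀ k, 0 ≤ d k := by
    intro k
    obtain ⟨j, rfl | rfl⟩ := hpar k
    · rw [hd0]
      exact hT.inner_nonneg (h.sub_mem j)
    · rw [hd1]
      exact hK.inner_nonneg (hsub j)
  set t : ℕ → ℝ := fun k => ∑ i ∈ Finset.range k, d i with htdef
  have htd : ∀ k, t (k + 1) - t k = d k := fun k => by
    simp only [htdef, Finset.sum_range_succ, add_sub_cancel_left]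
  -- A segment of duration zero is a single point, since a normal orthogonal to its base point
  -- vanishes.
  have hXeq : ∀ k, t k = t (k + 1) → X k = X (k + 1) := by
    intro k hk
    have hdk : d k = 0 := by rw [← htd, hk, sub_self]
    obtain ⟨j, rfl | rfl⟩ := hpar k
    · rw [hd0] at hdk
      rw [hX0, hX1, sub_eq_zero.1 (hT.eq_zero_of_inner_eq_zero (h.sub_mem j) hdk)]
    · rw [hd1] at hdk
      rw [hX1, hX2, sub_eq_zero.1 (hK.eq_zero_of_inner_eq_zero (hsub j) hdk)]
  have htN : t (2 * m) = 2 * ellLength T m q := by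
    have key : ∀ n, t (2 * n) = ∑ j ∈ Finset.range n,
        (inner ℝ (q (j + 1) - q j) (p j) + inner ℝ (p j - p (j + 1)) (q (j + 1)) : ℝ) := by
      intro n
      induction n with
      | zero => simp [htdef]
      | succ n ih =>
        rw [Finset.sum_range_succ, ← ih, ← hd0, ← hd1, ← htd, ← htd]
        ring_nf
    rw [key, Finset.sum_add_distrib, sum_inner_sub_eq h.periodic h.periodic_dual,
      ← h.ellLength_eq hT]
    ring
  have ht0 : t 0 = 0 := by simp [htdef]
  have hXN : X (2 * m) = X 0 := by
    rw [hX0, ← mul_zero 2, hX0, h.periodic.eq, h.periodic_dual.eq]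
  have htmono : ∀ k, t k ≤ t (k + 1) := fun k => sub_nonneg.1 (htd k ▸ hdnn k)
  have hline0 : ∀ j (s : ℝ), AffineMap.lineMap (X (2 * j)) (X (2 * j + 1)) s =
      (AffineMap.lineMap (q j) (q (j + 1)) s, p j) := fun j s => by
    rw [hX0, hX1]
    ext <;> simp [AffineMap.lineMap_apply]
  have hline1 : ∀ j (s : ℝ), AffineMap.lineMap (X (2 * j + 1)) (X (2 * j + 1 + 1)) s =
      (q (j + 1), AffineMap.lineMap (p j) (p (j + 1)) s) := fun j s => by
    rw [hX1, hX2]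
    ext <;> simp [AffineMap.lineMap_apply]
  -- One subgradient `y` serves a whole segment: one component is zero, the other is the
  -- displacement (with the sign from `J`) divided by the duration.
  have hseg : ∀ k, t k < t (k + 1) → ∃ y : E × E,
      J y = (t (k + 1) - t k)⁻¹ • (X (k + 1) - X k) ∧ ∀ s ∈ Icc (0 : ℝ) 1,
        hamiltonian (K ×ˢ T) (AffineMap.lineMap (X k) (X (k + 1)) s) = 1 / 2 ∧
        y ∈ subdifferential (hamiltonian (K ×ˢ T)) (AffineMap.lineMap (X k) (X (k + 1)) s) := by
    intro k hk
    rw [htd]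
    have hdk : 0 < d k := by rw [← htd]; linarith
    obtain ⟨j, rfl | rfl⟩ := hpar k
    · refine ⟨(0, (d (2 * j))⁻¹ • (q (j + 1) - q j)), ?_, fun s hs => ?_⟩
      · rw [hX0, hX1]
        ext <;> simp [J]
      have hmem : AffineMap.lineMap (q j) (q (j + 1)) s ∈ K :=
        hK.convex.lineMap_mem (h.mem j) (h.mem (j + 1)) hs
      rw [hline0]
      have hham : hamiltonian (K ×ˢ T) (AffineMap.lineMap (q j) (q (j + 1)) s, p j) = 1 / 2 :=
        hamiltonian_prod_eq_half hK hT ⟨hmem, h.dual_mem j⟩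
          (Or.inr (mem_frontier_of_inner_pos (h.dual_mem j) (h.sub_mem j) (by rwa [← hd0])))
      refine ⟨hham, mem_subdifferential_of_mem_normalCone hK hT hham zero_mem_normalCone
        (smul_mem_normalCone (h.sub_mem j) (inv_nonneg.2 hdk.le)) ?_⟩
      simp only [pairing, inner_zero_left, zero_add]
      rw [real_inner_smul_left, ← hd0, inv_mul_cancel₀ hdk.ne']
    · refine ⟨((d (2 * j + 1))⁻¹ • (p j - p (j + 1)), 0), ?_, fun s hs => ?_⟩
      · rw [hX1, hX2]
        ext <;> simp [J, ← smul_neg]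
      have hmem : AffineMap.lineMap (p j) (p (j + 1)) s ∈ T :=
        hT.convex.lineMap_mem (h.dual_mem j) (h.dual_mem (j + 1)) hs
      rw [hline1]
      have hham : hamiltonian (K ×ˢ T) (q (j + 1), AffineMap.lineMap (p j) (p (j + 1)) s) = 1 / 2 :=
        hamiltonian_prod_eq_half hK hT ⟨h.mem (j + 1), hmem⟩
          (Or.inl (mem_frontier_of_inner_pos (h.mem (j + 1)) (hsub j) (by rwa [← hd1])))
      refine ⟨hham, mem_subdifferential_of_mem_normalCone hK hT hham
        (smul_mem_normalCone (hsub j) (inv_nonneg.2 hdk.le)) zero_mem_normalCone ?_⟩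
      simp only [pairing, inner_zero_left, add_zero]
      rw [real_inner_smul_left, ← hd1, inv_mul_cancel₀ hdk.ne']
  obtain ⟨x, hper, hac, hxline, hxall, hxae⟩ := exists_periodic_piecewise_affine htmono hXeq ht0
    htN (by linarith) hXN
  refine ⟨x, ⟨by linarith, hper, hac, ?_, fun u => ?_⟩, t, fun k _ => htmono k, ?_, ?_, ?_⟩
  · filter_upwards [hxae] with u ⟨k, hk, hlt, ⟨s, hs, hxs⟩, hder⟩
    obtain ⟨y, hy, hys⟩ := hseg k hlt
    exact ⟨y, hxs ▸ (hys s hs).2, hy ▸ hder⟩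
  · obtain ⟨k, hk, hlt, s, hs, hxs⟩ := hxall u
    obtain ⟨y, hy, hys⟩ := hseg k hlt
    exact hxs ▸ (hys s hs).1
  · rw [htN, ht0, zero_add]
  · intro j hj s hs
    rw [hxline _ (by omega) s hs, hline0]
  · intro j hj s hs
    exact (hxline _ (by omega) s hs).trans (hline1 j s)

/-- Consecutive break points are distinct, so no segment is traversed in no time. -/
theorem IsPolygonalLoop.hasChangingPoints {τ : ℝ} {x : ℝ → E × E} (h : IsPolygonalLoop τ x m q p)
    (hq : ∀ j, q j ≠ q (j + 1)) (hp : ∀ j, p j ≠ p (j + 1)) : HasChangingPoints τ x m q p := by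
  obtain ⟨t, hmono, hτ, h0, h1⟩ := h
  have hz : (0 : ℝ) ∈ Icc (0 : ℝ) 1 := ⟨le_rfl, zero_le_one⟩
  have ho : (1 : ℝ) ∈ Icc (0 : ℝ) 1 := ⟨zero_le_one, le_rfl⟩
  have ha : ∀ j < m, x (t (2 * j)) = (q j, p j) := fun j hj => by simpa using h0 j hj 0 hz
  have hb : ∀ j < m, x (t (2 * j + 1)) = (q (j + 1), p j) := fun j hj => by
    simpa using h0 j hj 1 ho
  have hc : ∀ j < m, x (t (2 * j + 2)) = (q (j + 1), p (j + 1)) := fun j hj => by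
    simpa using h1 j hj 1 ho
  have key : ∀ {a b : ℝ}, a < b → ∀ s ∈ Icc a b, ∃ r ∈ Icc (0 : ℝ) 1,
      AffineMap.lineMap a b r = s := by
    intro a b hab s hs
    have : s ∈ segment ℝ a b := by rwa [segment_eq_Icc hab.le]
    rwa [segment_eq_image_lineMap] at this
  have hlt0 : ∀ j < m, t (2 * j) < t (2 * j + 1) := fun j hj => by
    refine lt_of_le_of_ne (hmono _ (by omega)) fun he => hq j ?_
    have h2 := ha j hj
    rw [he, hb j hj] at h2
    exact (Prod.ext_iff.1 h2).1.symm
  have hlt1 : ∀ j < m, t (2 * j + 1) < t (2 * j + 2) := fun j hj => by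
    refine lt_of_le_of_ne (hmono _ (by omega)) fun he => hp j ?_
    have h2 := hb j hj
    rw [he, hc j hj] at h2
    exact (Prod.ext_iff.1 h2).2.symm
  refine ⟨t, fun k hk => ?_, hτ, fun j hj => ⟨ha j hj, hb j hj, hc j hj⟩, fun j hj s hs => ?_,
    fun j hj s hs => ?_⟩
  · obtain ⟨j, rfl | rfl⟩ : ∃ j, k = 2 * j ∨ k = 2 * j + 1 := ⟨k / 2, by omega⟩
    · exact hlt0 j (by omega)
    · exact hlt1 j (by omega)
  · obtain ⟨r, hr, rfl⟩ := key (hlt0 j hj) s hs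
    rw [h0 j hj r hr]
  · obtain ⟨r, hr, rfl⟩ := key (hlt1 j hj) s hs
    rw [h1 j hj r hr]

theorem IsBilliardPair.ellLength_pos (hK : IsConvexBody K) (hT : IsConvexBody T)
    (h : IsBilliardPair K T m q p) : 0 < ellLength T m q := by
  rw [(h.isWeakPair hK hT).ellLength_eq hT]
  refine Finset.sum_pos (fun j _ => hT.inner_pos (h.sub_mem j)
    (sub_ne_zero.2 (h.polygon.ne_succ j).symm)) ?_
  rw [Finset.nonempty_range_iff]
  have := h.polygon.two_le
  omega

end

/-! ### Support functions and shortest tight polygons -/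

section

variable {E : Type*} [NormedAddCommGroup E] [InnerProductSpace ℝ E] {K T : Set E}

section supportFunction

variable (hT : IsConvexBody T)

include hT

theorem IsConvexBody.exists_mem_normalCone (v : E) : ∃ p ∈ T, v ∈ normalCone T p := by
  obtain ⟨p, hp, hmax⟩ := hT.isCompact.exists_isMaxOn ⟨0, hT.zero_mem⟩
    (f := fun y => (inner ℝ v y : ℝ)) (by fun_prop)
  refine ⟨p, hp, fun y hy => ?_⟩
  rw [inner_sub_right]
  have : (inner ℝ v y : ℝ) ≤ inner ℝ v p := hmax hy
  linarith

theorem IsConvexBody.inner_le_gauge_polarBody {p : E} (hp : p ∈ T) (v : E) :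
    (inner ℝ v p : ℝ) ≤ gauge (polarBody T) v := by
  obtain ⟨p', hp', hv⟩ := hT.exists_mem_normalCone v
  rw [gauge_polarBody hT hp' hv]
  exact inner_le_of_mem_normalCone hv hp

theorem IsConvexBody.mem_normalCone_of_gauge_polarBody_le {p v : E}
    (h : gauge (polarBody T) v ≤ inner ℝ v p) : v ∈ normalCone T p := fun y hy => by
  rw [inner_sub_right]
  have := hT.inner_le_gauge_polarBody hy v
  linarith

theorem IsConvexBody.gauge_polarBody_add_le (v w : E) :
    gauge (polarBody T) (v + w) ≤ gauge (polarBody T) v + gauge (polarBody T) w := by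
  obtain ⟨p, hp, h⟩ := hT.exists_mem_normalCone (v + w)
  rw [gauge_polarBody hT hp h, inner_add_left]
  exact add_le_add (hT.inner_le_gauge_polarBody hp v) (hT.inner_le_gauge_polarBody hp w)

theorem IsConvexBody.gauge_polarBody_pos {v : E} (hv : v ≠ 0) : 0 < gauge (polarBody T) v := by
  obtain ⟨p, hp, h⟩ := hT.exists_mem_normalCone v
  rw [gauge_polarBody hT hp h]
  exact hT.inner_pos h hv

theorem IsConvexBody.continuous_gauge_polarBody : Continuous (gauge (polarBody T)) := by
  obtain ⟨R, hR⟩ := hT.isCompact.isBounded.exists_norm_le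
  have hR0 : 0 ≤ R := (norm_nonneg 0).trans (hR 0 hT.zero_mem)
  refine (LipschitzWith.of_le_add_mul ⟨R, hR0⟩ fun v w => ?_).continuous
  obtain ⟨p, hp, h⟩ := hT.exists_mem_normalCone v
  have h1 := hT.inner_le_gauge_polarBody hp w
  have h2 := real_inner_le_norm (v - w) p
  have h3 : ‖v - w‖ * ‖p‖ ≤ R * dist v w := by
    rw [dist_eq_norm, mul_comm]
    exact mul_le_mul_of_nonneg_right (hR p hp) (norm_nonneg _)
  rw [gauge_polarBody hT hp h]
  rw [inner_sub_left] at h2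
  change _ ≤ _ + R * dist v w
  linarith

theorem gauge_polarBody_sub_le_sum (q : ℕ → E) {a b : ℕ} (hab : a ≤ b) :
    gauge (polarBody T) (q b - q a) ≤
      ∑ j ∈ Finset.Ico a b, gauge (polarBody T) (q (j + 1) - q j) := by
  induction b, hab using Nat.le_induction with
  | base => simp
  | succ b hab ih =>
    rw [Finset.sum_Ico_succ_top hab, ← sub_add_sub_cancel' (q b) (q a) (q (b + 1))]
    exact (hT.gauge_polarBody_add_le _ _).trans (add_le_add_left ih _)

end supportFunction

section periodicSums

theorem sum_range_succ_of_periodic {M : Type*} [AddCommGroup M] {F : ℕ → M} {k : ℕ}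
    (hF : Function.Periodic F k) :
    ∑ j ∈ Finset.range k, F (j + 1) = ∑ j ∈ Finset.range k, F j := by
  have h1 := Finset.sum_range_succ F k
  rw [Finset.sum_range_succ', hF.eq] at h1
  exact add_right_cancel h1

theorem sum_Ico_of_periodic {M : Type*} [AddCommGroup M] {F : ℕ → M} {k : ℕ}
    (hF : Function.Periodic F k) (a : ℕ) :
    ∑ j ∈ Finset.Ico a (a + k), F j = ∑ j ∈ Finset.range k, F j := by
  rw [Finset.sum_Ico_eq_sum_range, add_tsub_cancel_left]
  induction a with
  | zero => simp
  | succ a ih =>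
    rw [← ih, ← sum_range_succ_of_periodic (F := fun i => F (a + i))
      (fun i => by simp only [← add_assoc, hF (a + i)])]
    refine Finset.sum_congr rfl fun j _ => ?_
    congr 1
    omega

theorem sum_Ico_telescope {M : Type*} [AddCommMonoid M] (F : ℕ → M) {φ : ℕ → ℕ} {k : ℕ}
    (hφ : ∀ i < k, φ i ≤ φ (i + 1)) :
    φ 0 ≤ φ k ∧ ∑ i ∈ Finset.range k, ∑ j ∈ Finset.Ico (φ i) (φ (i + 1)), F j =
      ∑ j ∈ Finset.Ico (φ 0) (φ k), F j := by
  induction k with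
  | zero => simp
  | succ k ih =>
    obtain ⟨h1, h2⟩ := ih fun i hi => hφ i (by omega)
    have h3 := hφ k (by omega)
    refine ⟨h1.trans h3, ?_⟩
    rw [Finset.sum_range_succ, h2, Finset.sum_Ico_consecutive _ h1 h3]

end periodicSums

/-- The closed polygons `q` in `K` with `k` vertices, together with normals `w j` to `K` at the
vertices that certify that `q` cannot be translated into the interior of `K`. -/
def tightPolygons (K : Set E) (k : ℕ) : Set ((ℕ → E) × (ℕ → E)) :=
  {x | Function.Periodic x.1 k ∧ Function.Periodic x.2 k ∧ (∀ j, x.1 j ∈ K) ∧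
    (∀ j, x.2 j ∈ normalCone K (x.1 j)) ∧ ∑ j ∈ Finset.range k, x.2 j = 0 ∧
    ∑ j ∈ Finset.range k, (inner ℝ (x.2 j) (x.1 j) : ℝ) = 1}

/-- The nonnegative terms `⟨w j, q j⟩` over one period sum to `1`, which bounds every `w j` by
`exists_mul_norm_le`. The normalization also keeps the certificate from degenerating to zero in a
limit. -/
theorem isCompact_tightPolygons [FiniteDimensional ℝ E] (hK : IsConvexBody K) {k : ℕ}
    (hk : 0 < k) : IsCompact (tightPolygons K k) := by
  have : ProperSpace E := FiniteDimensional.proper ℝ E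
  obtain ⟨r, hr, H⟩ := hK.exists_mul_norm_le
  have hcpt : IsCompact ((univ.pi fun _ : ℕ => K) ×ˢ
      (univ.pi fun _ : ℕ => Metric.closedBall (0 : E) (1 / r))) :=
    (isCompact_univ_pi fun _ => hK.isCompact).prod
      (isCompact_univ_pi fun _ => isCompact_closedBall _ _)
  refine hcpt.of_isClosed_subset ?_ ?_
  · have hc1 : ∀ j, Continuous fun x : (ℕ → E) × (ℕ → E) => x.1 j := fun j => by fun_prop
    have hc2 : ∀ j, Continuous fun x : (ℕ → E) × (ℕ → E) => x.2 j := fun j => by fun_prop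
    have hN : ∀ j, IsClosed {x : (ℕ → E) × (ℕ → E) | x.2 j ∈ normalCone K (x.1 j)} := fun j => by
      have : {x : (ℕ → E) × (ℕ → E) | x.2 j ∈ normalCone K (x.1 j)} =
          ⋂ y ∈ K, {x | (inner ℝ (x.2 j) (y - x.1 j) : ℝ) ≤ 0} := by
        ext x
        simp [normalCone]
      rw [this]
      exact isClosed_biInter fun y _ =>
        isClosed_le ((hc2 j).inner (continuous_const.sub (hc1 j))) continuous_const
    simp only [tightPolygons, Function.Periodic, ofPred_and, ofPred_forall]
    refine IsClosed.inter (isClosed_iInter fun j => isClosed_eq (hc1 _) (hc1 _))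
      (IsClosed.inter (isClosed_iInter fun j => isClosed_eq (hc2 _) (hc2 _))
      (IsClosed.inter (isClosed_iInter fun j => hK.isCompact.isClosed.preimage (hc1 j))
      (IsClosed.inter (isClosed_iInter hN)
      (IsClosed.inter (isClosed_eq (continuous_finsetSum _ fun j _ => hc2 j) continuous_const)
        (isClosed_eq (continuous_finsetSum _ fun j _ => (hc2 j).inner (hc1 j))
          continuous_const)))))
  · rintro ⟨q, w⟩ ⟨hq, hw, hqK, hwK, -, hsum⟩
    refine ⟨fun j _ => hqK j, fun j _ => ?_⟩
    have h1 : (inner ℝ (w (j % k)) (q (j % k)) : ℝ) ≤ 1 := by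
      rw [← hsum]
      exact Finset.single_le_sum (f := fun j => (inner ℝ (w j) (q j) : ℝ))
        (fun i _ => hK.inner_nonneg (hwK i)) (Finset.mem_range.2 (Nat.mod_lt _ hk))
    have h2 := H _ _ (hwK (j % k))
    simp only at hw h1 h2 ⊢
    rw [mem_closedBall_zero_iff, ← hw.map_mod_nat j, le_div_iff₀ hr]
    linarith

theorem exists_inner_eq_of_dual [CompleteSpace E] {k : ℕ} (f : (Fin k → E) →L[ℝ] ℝ) :
    ∃ v : Fin k → E, (∀ i y, f (Pi.single i y) = inner ℝ (v i) y) ∧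
      ∀ y, f y = ∑ i, inner ℝ (v i) (y i) := by
  refine ⟨fun i => (InnerProductSpace.toDual ℝ E).symm
    (f.comp (ContinuousLinearMap.single ℝ (fun _ => E) i)), fun i y => ?_, fun y => ?_⟩
  · simp [InnerProductSpace.toDual_symm_apply]
  · conv_lhs => rw [← Finset.univ_sum_single y, map_sum]
    simp [InnerProductSpace.toDual_symm_apply]

theorem sum_range_mod {M : Type*} [AddCommMonoid M] {k : ℕ} (hk : 0 < k) (F : Fin k → M) :
    ∑ j ∈ Finset.range k, F ⟨j % k, Nat.mod_lt _ hk⟩ = ∑ i, F i := by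
  rw [Finset.sum_range]
  refine Finset.sum_congr rfl fun i _ => ?_
  congr 1
  ext
  exact Nat.mod_eq_of_lt i.2

/-- A closed polygon in `K` that cannot be translated into the interior of `K` is tight. -/
theorem exists_mem_tightPolygons [CompleteSpace E] (hK : IsConvexBody K) {k : ℕ} (hk : 0 < k)
    {q : ℕ → E} (hq : Function.Periodic q k) (hqK : ∀ j, q j ∈ K)
    (hnot : ∀ c, ∃ j, q j + c ∉ interior K) : ∃ w, (q, w) ∈ tightPolygons K k := by
  set q' : Fin k → E := fun i => q i with hq'
  have hqmod : ∀ j, q' ⟨j % k, Nat.mod_lt _ hk⟩ = q j := fun j => hq.map_mod_nat j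
  -- Separate the `k`-fold power of `interior K` from the affine space of translates of `q`; the
  -- components of the functional are the sought normals.
  obtain ⟨f, u, hfU, hfA⟩ := geometric_hahn_banach_open
    (s := univ.pi fun _ : Fin k => interior K) (t := range fun (c : E) (i : Fin k) => q' i + c)
    (convex_pi fun _ _ => hK.convex.interior)
    (isOpen_set_pi finite_univ fun _ _ => isOpen_interior)
    (by
      rintro _ ⟨c, rfl⟩ _ ⟨d, rfl⟩ a b - - hab
      refine ⟨a • c + b • d, ?_⟩
      funext i
      have : q' i = (a + b) • q' i := by rw [hab, one_smul]
      simp only [Pi.add_apply, Pi.smul_apply, smul_add]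
      nth_rewrite 1 [this]
      rw [add_smul]
      abel)
    (by
      rw [disjoint_left]
      rintro _ hU ⟨c, rfl⟩
      obtain ⟨j, hj⟩ := hnot c
      refine hj ?_
      rw [← hqmod j]
      exact hU ⟨j % k, Nat.mod_lt _ hk⟩ (mem_univ _))
  obtain ⟨v, hv1, hv⟩ := exists_inner_eq_of_dual f
  have hA : ∀ c, u ≤ f q' + inner ℝ (∑ i, v i) c := by
    intro c
    have := hfA _ ⟨c, rfl⟩
    rw [hv] at this ⊢
    simpa only [inner_add_right, Finset.sum_add_distrib, ← sum_inner] using this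
  have huq : u ≤ f q' := by simpa using hA 0
  -- The functional is bounded below on all translates, so it cannot change under translation.
  have hV : ∑ i, v i = 0 := by
    by_contra hne
    set V := ∑ i, v i
    have hV0 : 0 < ‖V‖ ^ 2 := by
      have := norm_pos_iff.2 hne
      positivity
    have := hA ((-(f q' - u + 1) / ‖V‖ ^ 2) • V)
    rw [inner_smul_right, real_inner_self_eq_norm_sq, div_mul_cancel₀ _ hV0.ne'] at this
    linarith
  -- Points of `K` scaled by `s < 1` are interior; letting `s` approach `1` extends the bound. With
  -- `huq`, `q'` maximizes `f` over polygons in `K`.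
  have hle : ∀ a : Fin k → E, (∀ i, a i ∈ K) → f a ≤ u := by
    intro a ha
    have h1 : ∀ s : ℝ, 0 < s → s < 1 → s * f a < u := by
      intro s hs hs1
      rw [← smul_eq_mul, ← map_smul]
      refine hfU _ fun i _ => ?_
      refine hK.convex.openSegment_interior_self_subset_interior hK.zero_mem_interior (ha i)
        ⟨1 - s, s, by linarith, hs, by ring, ?_⟩
      simp
    by_contra! hlt
    have hu : 0 < u := by simpa using hfU 0 fun i _ => hK.zero_mem_interior
    have hfa : 0 < f a := hu.trans hlt
    have := h1 (u / f a) (div_pos hu hfa) ((div_lt_one hfa).2 hlt)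
    rw [div_mul_cancel₀ _ hfa.ne'] at this
    exact lt_irrefl _ this
  have hnorm : ∀ i, v i ∈ normalCone K (q' i) := by
    intro i y hy
    have := hle (q' + Pi.single i (y - q' i)) fun i' => by
      by_cases h : i' = i
      · subst h
        simpa using hy
      · simpa [Pi.single_eq_of_ne h] using hqK i'
    rw [map_add, hv1] at this
    linarith
  have hpos : 0 < f q' :=
    lt_of_lt_of_le (by simpa using hfU 0 fun i _ => hK.zero_mem_interior) huq
  refine ⟨fun j => (f q')⁻¹ • v ⟨j % k, Nat.mod_lt _ hk⟩, hq, fun j => ?_, hqK, fun j => ?_, ?_, ?_⟩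
  · simp only [Nat.add_mod_right]
  · have := smul_mem_normalCone (hnorm ⟨j % k, Nat.mod_lt _ hk⟩) (inv_nonneg.2 hpos.le)
    rwa [hqmod] at this
  · rw [sum_range_mod hk (fun i => (f q')⁻¹ • v i), ← Finset.smul_sum, hV, smul_zero]
  · have h1 : ∀ j, (inner ℝ ((f q')⁻¹ • v ⟨j % k, Nat.mod_lt _ hk⟩) (q j) : ℝ) =
        (fun i => (f q')⁻¹ * (inner ℝ (v i) (q' i) : ℝ)) ⟨j % k, Nat.mod_lt _ hk⟩ := fun j => by
      simp only [real_inner_smul_left, hqmod]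
    simp only [h1]
    rw [sum_range_mod hk (fun i => (f q')⁻¹ * (inner ℝ (v i) (q' i) : ℝ)), ← Finset.mul_sum, ← hv,
      inv_mul_cancel₀ hpos.ne']

theorem ellLength_smul_add (q : ℕ → E) {s : ℝ} (hs : 0 ≤ s) (c : E) (k : ℕ) :
    ellLength T k (fun j => s • q j + c) = s * ellLength T k q := by
  simp only [ellLength, Finset.mul_sum, add_sub_add_right_eq_sub, ← smul_sub,
    gauge_smul_of_nonneg hs, smul_eq_mul]

theorem ellLength_nonneg (q : ℕ → E) (k : ℕ) : 0 ≤ ellLength T k q :=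
  Finset.sum_nonneg fun _ _ => gauge_nonneg _

/-- A closed polygon that cannot be translated into the interior of `K` is homothetic to a tight
polygon that is not longer. -/
theorem exists_tight_ellLength_le [CompleteSpace E] (hK : IsConvexBody K) {k : ℕ} (hk : 0 < k)
    {q : ℕ → E} (hq : Function.Periodic q k) (hnot : ∀ c, ∃ j, q j + c ∉ interior K) :
    ∃ x ∈ tightPolygons K k, ellLength T k x.1 ≤ ellLength T k q := by
  -- Choose the largest factor at most `1` for which a translate of the scaled polygon fits into
  -- `K`; recording the position of vertex `0` makes the choice compact. At the maximum no translate
  -- is interior: a factor below `1` could be enlarged, and for factor `1` this is the hypothesis.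
  set S : Set (ℝ × E) := {x | x ∈ Icc (0 : ℝ) 1 ×ˢ K ∧ ∀ j, x.1 • (q j - q 0) + x.2 ∈ K} with hS
  have hScpt : IsCompact S := by
    have : S = (Icc (0 : ℝ) 1 ×ˢ K) ∩
        ⋂ j, (fun x : ℝ × E => x.1 • (q j - q 0) + x.2) ⁻¹' K := by
      ext x
      simp [hS]
    rw [this]
    exact (isCompact_Icc.prod hK.isCompact).inter_right
      (isClosed_iInter fun j => hK.isCompact.isClosed.preimage (by fun_prop))
  obtain ⟨⟨s, y⟩, ⟨⟨⟨hs0, hs1⟩, hy⟩, hsy⟩, hmax⟩ := hScpt.exists_isMaxOn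
    ⟨(0, 0), ⟨⟨⟨le_rfl, zero_le_one⟩, hK.zero_mem⟩, fun j => by simpa using hK.zero_mem⟩⟩
    (continuous_fst.continuousOn)
  simp only at hs0 hs1 hy hsy
  have hper : Function.Periodic (fun j => s • q j + (y - s • q 0)) k := fun j => by
    simp only [hq j]
  obtain ⟨w, hw⟩ := exists_mem_tightPolygons hK hk hper
    (fun j => by
      have := hsy j
      rwa [smul_sub, sub_add_eq_add_sub, add_sub_assoc] at this)
    (fun c => by
      by_contra! hcon
      rcases hs1.eq_or_lt with rfl | hlt
      · obtain ⟨j, hj⟩ := hnot (y - (1 : ℝ) • q 0 + c)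
        refine hj ?_
        have := hcon j
        rwa [one_smul, add_assoc] at this
      · have h1 : ∀ j, ∀ᶠ r : ℝ in nhds s, r • q j + (y - r • q 0) + c ∈ interior K := fun j => by
          have hc : Continuous fun r : ℝ => r • q j + (y - r • q 0) + c := by fun_prop
          exact (hc.tendsto s).eventually (isOpen_interior.mem_nhds (hcon j))
        have h2 : ∀ᶠ r : ℝ in nhds s, ∀ j ∈ Finset.range k,
            r • q j + (y - r • q 0) + c ∈ interior K :=
          (Filter.eventually_all_finset _).2 fun j _ => h1 j
        have h3 : ∀ᶠ r : ℝ in nhdsWithin s (Ioi s), r ∈ Ioo s 1 := Ioo_mem_nhdsGT hlt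
        obtain ⟨r, hr, hrs⟩ := ((h2.filter_mono nhdsWithin_le_nhds).and h3).exists
        have h4 : ∀ j, r • q j + (y - r • q 0) + c ∈ K := fun j => by
          rw [← hq.map_mod_nat j]
          exact interior_subset (hr _ (Finset.mem_range.2 (Nat.mod_lt _ hk)))
        have h5 : (r, y + c) ∈ S := by
          refine ⟨⟨⟨hs0.trans hrs.1.le, hrs.2.le⟩, ?_⟩, fun j => ?_⟩
          · have := h4 0
            rwa [add_sub_cancel] at this
          · have := h4 j
            simp only [smul_sub]
            convert this using 1
            abel
        exact (not_le.2 hrs.1) (hmax h5))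
  refine ⟨_, hw, ?_⟩
  rw [ellLength_smul_add q hs0]
  have := ellLength_nonneg (T := T) q k
  nlinarith

/-- The defining functional of a shortest tight polygon is dominated by the length. -/
theorem mul_sum_inner_le_ellLength [CompleteSpace E] (hK : IsConvexBody K) {k : ℕ} (hk : 0 < k)
    {q w : ℕ → E} (hx : (q, w) ∈ tightPolygons K k)
    (hmin : ∀ x ∈ tightPolygons K k, ellLength T k q ≤ ellLength T k x.1) {q' : ℕ → E}
    (hq' : Function.Periodic q' k) :
    ellLength T k q * ∑ j ∈ Finset.range k, inner ℝ (w j) (q' j) ≤ ellLength T k q' := by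
  obtain ⟨hq, hw, hqK, hwK, hw0, hw1⟩ := hx
  simp only at hq hw hqK hwK hw0 hw1
  set a : ℝ := ∑ j ∈ Finset.range k, inner ℝ (w j) (q' j) with ha
  rcases le_or_gt a 0 with ha0 | ha0
  · exact (mul_nonpos_of_nonneg_of_nonpos (ellLength_nonneg q k) ha0).trans (ellLength_nonneg q' k)
  -- The form `∑ ⟨w j, ·⟩` is translation invariant, at most `1` on polygons in `K`, and equal to
  -- `1` on `a⁻¹ • q'`. Attaining this maximum at interior points would force every `w j` to vanish.
  have hnot : ∀ c, ∃ j, (a⁻¹ • q' j + 0) + c ∉ interior K := by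
    intro c
    by_contra! hcon
    have h1 : ∑ j ∈ Finset.range k, (inner ℝ (w j) (a⁻¹ • q' j + 0 + c) : ℝ) = 1 := by
      simp only [inner_add_right, inner_smul_right, add_zero,
        Finset.sum_add_distrib, ← Finset.mul_sum, ← ha, ← sum_inner, hw0, inner_zero_left]
      exact inv_mul_cancel₀ ha0.ne'
    have h2 : ∀ j ∈ Finset.range k,
        (inner ℝ (w j) (a⁻¹ • q' j + 0 + c) : ℝ) ≤ inner ℝ (w j) (q j) := fun j _ =>
      inner_le_of_mem_normalCone (hwK j) (interior_subset (hcon j))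
    have h3 := (Finset.sum_eq_sum_iff_of_le h2).1 (h1.trans hw1.symm)
    have h4 : ∀ j ∈ Finset.range k, w j = 0 := by
      intro j hj
      by_contra hne
      refine notMem_interior_of_mem_normalCone (K := K) (v := w j)
        (z := a⁻¹ • q' j + 0 + c) (fun y hy => ?_) hne (hcon j)
      rw [inner_sub_right, h3 j hj]
      have := inner_le_of_mem_normalCone (hwK j) hy
      linarith
    rw [Finset.sum_congr rfl fun j hj => by rw [h4 j hj, inner_zero_left]] at hw1
    simp at hw1
  obtain ⟨x, hx, hle⟩ := exists_tight_ellLength_le (T := T) hK hk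
    (fun j => by simp only [hq' j]) hnot
  rw [ellLength_smul_add q' (inv_nonneg.2 ha0.le)] at hle
  have := (hmin x hx).trans hle
  rwa [inv_mul_eq_div, le_div_iff₀ ha0] at this

/-- The multipliers of a shortest tight polygon form a closed polygon in `T`. -/
theorem exists_dual_polygon [CompleteSpace E] (hT : IsConvexBody T) {k : ℕ}
    (hk : 0 < k) {w : ℕ → E} (hw : Function.Periodic w k) {l : ℝ}
    (h : ∀ q' : ℕ → E, Function.Periodic q' k →
      l * ∑ j ∈ Finset.range k, inner ℝ (w j) (q' j) ≤ ellLength T k q') :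
    ∃ p : ℕ → E, Function.Periodic p k ∧ (∀ j, p j ∈ T) ∧
      ∀ j, p j - p (j + 1) = l • w (j + 1) := by
  have hmod : ∀ j, j % k < k := fun j => Nat.mod_lt _ hk
  -- Up to an index shift, `ℓ_T` is the support function of the compact convex set `A` of difference
  -- sequences of polygons in `T`. A form dominated by a support function belongs to the set.
  set D : (Fin k → E) →L[ℝ] (Fin k → E) := ContinuousLinearMap.pi fun i =>
    ContinuousLinearMap.proj (R := ℝ) (φ := fun _ : Fin k => E) i -
      ContinuousLinearMap.proj (R := ℝ) (φ := fun _ : Fin k => E) ⟨(i + 1) % k, hmod _⟩ with hD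
  have hDapp : ∀ p i, D p i = p i - p ⟨(i + 1) % k, hmod _⟩ := fun p i => rfl
  set A : Set (Fin k → E) := D '' univ.pi fun _ => T with hA
  have hAcl : IsClosed A :=
    ((isCompact_univ_pi fun _ => hT.isCompact).image D.continuous).isClosed
  have hAconv : Convex ℝ A := (convex_pi fun _ _ => hT.convex).is_linear_image D.isLinear
  by_cases hz : (fun i : Fin k => l • w (i + 1)) ∈ A
  · obtain ⟨p, hp, hpz⟩ := hz
    refine ⟨fun j => p ⟨j % k, hmod j⟩, fun j => by simp only [Nat.add_mod_right],
      fun j => hp _ (mem_univ _), fun j => ?_⟩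
    have h1 := congrFun hpz ⟨j % k, hmod j⟩
    rw [hDapp] at h1
    simp only [Nat.mod_add_mod] at h1
    rw [h1, ← hw.map_mod_nat (j % k + 1), ← hw.map_mod_nat (j + 1), Nat.mod_add_mod]
  exfalso
  obtain ⟨f, u, hfA, hfz⟩ := geometric_hahn_banach_closed_point hAconv hAcl hz
  obtain ⟨v, -, hv⟩ := exists_inner_eq_of_dual f
  -- Adding `k - 1` is subtracting `1` modulo `k`: the form pairs `q' (j + 1)` with the difference
  -- `p j - p (j + 1)`.
  set q' : ℕ → E := fun j => v ⟨(j + (k - 1)) % k, hmod _⟩ with hq'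
  have hq'1 : ∀ j, q' (j + 1) = v ⟨j % k, hmod j⟩ := fun j => by
    simp only [hq']
    congr 2
    rw [show j + 1 + (k - 1) = j + k by omega, Nat.add_mod_right]
  have hq'p : Function.Periodic q' k := fun j => by
    have : (j + k + (k - 1)) % k = (j + (k - 1)) % k := by
      rw [show j + k + (k - 1) = j + (k - 1) + k by omega, Nat.add_mod_right]
    simp only [hq', this]
  -- These points attain the support function on each side of `q'`, so the separating functional
  -- reaches `ℓ_T(q')` on `A`, against `h`.
  choose P hPT hP using fun j => hT.exists_mem_normalCone (q' (j + 1) - q' j)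
  set p : ℕ → E := fun j => P (j % k) with hp
  have hpp : Function.Periodic p k := fun j => by simp only [hp, Nat.add_mod_right]
  have hpn : ∀ j ∈ Finset.range k, (inner ℝ (q' (j + 1) - q' j) (p j) : ℝ) =
      gauge (polarBody T) (q' (j + 1) - q' j) := fun j hj => by
    simp only [hp]
    rw [Nat.mod_eq_of_lt (Finset.mem_range.1 hj), gauge_polarBody hT (hPT j) (hP j)]
  have h1 : f (D fun i => p i) = ellLength T k q' := by
    rw [ellLength, ← Finset.sum_congr rfl hpn, ← sum_inner_sub_eq hq'p hpp, hv,
      ← sum_range_mod hk]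
    refine Finset.sum_congr rfl fun j _ => ?_
    rw [hDapp, hq'1, real_inner_comm]
    simp only [Nat.mod_add_mod]
    rw [hpp.map_mod_nat, hpp.map_mod_nat]
  have h2 : f (fun i : Fin k => l • w (i + 1)) =
      l * ∑ j ∈ Finset.range k, inner ℝ (w j) (q' j) := by
    rw [← sum_range_succ_of_periodic (F := fun j => (inner ℝ (w j) (q' j) : ℝ))
      (fun j => by simp only [hw j, hq'p j]), hv, ← sum_range_mod hk, Finset.mul_sum]
    refine Finset.sum_congr rfl fun j _ => ?_
    rw [hq'1, inner_smul_right, real_inner_comm]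
    congr 2
    rw [← hw.map_mod_nat, Nat.mod_add_mod, hw.map_mod_nat]
  have h3 := hfA _ ⟨fun i => p i, fun i _ => hPT _, rfl⟩
  have h4 := h q' hq'p
  rw [h1] at h3
  rw [h2] at hfz
  linarith

theorem ellLength_pos_of_mem_tightPolygons (hT : IsConvexBody T) {k : ℕ} {q w : ℕ → E}
    (hx : (q, w) ∈ tightPolygons K k) : 0 < ellLength T k q := by
  obtain ⟨hq, -, -, -, hw0, hw1⟩ := hx
  simp only at hq hw0 hw1
  refine lt_of_le_of_ne (ellLength_nonneg q k) fun h => ?_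
  have h1 := (Finset.sum_eq_zero_iff_of_nonneg fun j _ => gauge_nonneg _).1 h.symm
  have h2 : ∀ j ≤ k, q j = q 0 := by
    intro j
    induction j with
    | zero => exact fun _ => rfl
    | succ j ih =>
      intro hj
      rw [← ih (by omega)]
      by_contra hne
      exact (hT.gauge_polarBody_pos (sub_ne_zero.2 hne)).ne' (h1 j (Finset.mem_range.2 (by omega)))
  rw [Finset.sum_congr rfl fun j hj => by rw [h2 j (Finset.mem_range.1 hj).le], ← sum_inner, hw0,
    inner_zero_left] at hw1
  exact zero_ne_one hw1

/-- A shortest tight polygon is a weak billiard trajectory. -/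
theorem exists_isWeakPair_of_minimal [CompleteSpace E] (hK : IsConvexBody K) (hT : IsConvexBody T)
    {k : ℕ} (hk : 0 < k) {q w : ℕ → E} (hx : (q, w) ∈ tightPolygons K k)
    (hmin : ∀ x ∈ tightPolygons K k, ellLength T k q ≤ ellLength T k x.1) :
    ∃ p, IsWeakPair K T k q p := by
  obtain ⟨p, hp, hpT, hpw⟩ := exists_dual_polygon hT hk hx.2.1 fun q' hq' =>
    mul_sum_inner_le_ellLength hK hk hx hmin hq'
  obtain ⟨hq, hw, hqK, hwK, hw0, hw1⟩ := hx
  simp only at hq hw hqK hwK hw0 hw1 hpw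
  -- Each summand is at most the gauge of the side, so equality of the sums forces equality in every
  -- term, which is normality to `T`.
  have h1 : ∑ j ∈ Finset.range k, (inner ℝ (q (j + 1) - q j) (p j) : ℝ) = ellLength T k q := by
    rw [← sum_inner_sub_eq hq hp]
    simp only [hpw, real_inner_smul_left, ← Finset.mul_sum]
    rw [sum_range_succ_of_periodic (F := fun j => (inner ℝ (w j) (q j) : ℝ))
      (fun j => by simp only [hw j, hq j]), hw1, mul_one]
  have h2 := (Finset.sum_eq_sum_iff_of_le fun j _ =>
    hT.inner_le_gauge_polarBody (hpT j) (q (j + 1) - q j)).1 h1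
  refine ⟨p, hq, hp, hqK, hpT, fun j => hT.mem_normalCone_of_gauge_polarBody_le ?_, fun j => ?_⟩
  · have h3 := h2 (j % k) (Finset.mem_range.2 (Nat.mod_lt _ hk))
    rw [hp.map_mod_nat, hq.map_mod_nat, ← hq.map_mod_nat, Nat.mod_add_mod, hq.map_mod_nat] at h3
    exact h3.ge
  · rw [neg_sub, hpw]
    exact smul_mem_normalCone (hwK _) (ellLength_nonneg q k)

end

/-! ### Reduction to few vertices and existence of minimizers -/

section

variable {E : Type*} [NormedAddCommGroup E] [InnerProductSpace ℝ E] {K T : Set E}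

/-- Carathéodory's theorem for a vanishing sum: finitely many vectors with vanishing sum and
nonnegative weights `b` have a positive combination of at most `dim E + 1` of them that vanishes. -/
theorem exists_small_vanishing_sum [FiniteDimensional ℝ E] {m : ℕ} {u : ℕ → E} {b : ℕ → ℝ}
    (hb : ∀ j, 0 ≤ b j) (hu : ∀ j, b j = 0 → u j = 0) (hbpos : 0 < ∑ j ∈ Finset.range m, b j)
    (hsum : ∑ j ∈ Finset.range m, u j = 0) :
    ∃ (J : Finset ℕ) (c : ℕ → ℝ), J ⊆ Finset.range m ∧ J.card ≤ Module.finrank ℝ E + 1 ∧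
      (∀ j, 0 ≤ c j) ∧ ∑ j ∈ J, c j • u j = 0 ∧ ∑ j ∈ J, c j * b j = 1 := by
  classical
  set I := (Finset.range m).filter fun j => b j ≠ 0 with hI
  have hbI : ∑ j ∈ I, b j = ∑ j ∈ Finset.range m, b j := Finset.sum_filter_ne_zero _
  -- With weights `b j`, zero is the centre of mass of the vectors `(b j)⁻¹ • u j`; indices with `b
  -- j = 0` contribute nothing. Carathéodory applies to this hull.
  have h0 : (0 : E) ∈ convexHull ℝ ((fun j => (b j)⁻¹ • u j) '' (I : Set ℕ)) := by
    have h1 : I.centerMass b (fun j => (b j)⁻¹ • u j) = 0 := by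
      rw [Finset.centerMass]
      have h2 : ∑ j ∈ I, b j • (b j)⁻¹ • u j = ∑ j ∈ Finset.range m, u j := by
        rw [hI, Finset.sum_filter]
        refine Finset.sum_congr rfl fun j _ => ?_
        split_ifs with h
        · exact smul_inv_smul₀ h _
        · rw [hu j (not_not.1 h)]
      rw [h2, hsum, smul_zero]
    rw [← h1]
    exact Finset.centerMass_mem_convexHull _ (fun j _ => hb j) (hbI ▸ hbpos)
      fun j hj => ⟨j, hj, rfl⟩
  obtain ⟨ι, _, z, w, hz, haff, hw0, hw1, hwz⟩ := eq_pos_convex_span_of_mem_convexHull h0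
  choose i hiI hiz using fun a : ι => hz ⟨a, rfl⟩
  have hinj : Function.Injective i := fun a a' haa => haff.injective (by
    rw [← hiz a, ← hiz a', haa])
  have hib : ∀ a, b (i a) ≠ 0 := fun a => (Finset.mem_filter.1 (hiI a)).2
  set c : ℕ → ℝ := fun j => ∑ a, if i a = j then w a * (b j)⁻¹ else 0 with hc
  have hci : ∀ a, c (i a) = w a * (b (i a))⁻¹ := by
    intro a
    simp only [hc, hinj.eq_iff]
    simp
  refine ⟨Finset.univ.image i, c, ?_, ?_, fun j => ?_, ?_, ?_⟩
  · intro j hj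
    obtain ⟨a, -, rfl⟩ := Finset.mem_image.1 hj
    exact (Finset.mem_filter.1 (hiI a)).1
  · exact Finset.card_image_le.trans (haff.card_le_finrank_succ.trans
      (Nat.succ_le_succ (Submodule.finrank_le _)))
  · refine Finset.sum_nonneg fun a _ => ?_
    split_ifs
    · exact mul_nonneg (hw0 a).le (inv_nonneg.2 (hb j))
    · exact le_rfl
  · rw [Finset.sum_image fun a _ a' _ h => hinj h, ← hwz]
    refine Finset.sum_congr rfl fun a _ => ?_
    rw [hci, mul_smul]
    exact congrArg _ (hiz a)
  · rw [Finset.sum_image fun a _ a' _ h => hinj h, ← hw1]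
    refine Finset.sum_congr rfl fun a _ => ?_
    rw [hci, inv_mul_cancel_right₀ (hib a)]

/-- Dropping vertices does not make a closed polygon longer. -/
theorem exists_subpolygon (hT : IsConvexBody T) {m : ℕ} {q : ℕ → E} (hq : Function.Periodic q m)
    {J : Finset ℕ} (hJ : J ⊆ Finset.range m) (hne : J.Nonempty) :
    ∃ φ : ℕ → ℕ, Function.Periodic φ J.card ∧
      (∀ F : ℕ → E, ∑ j ∈ Finset.range J.card, F (φ j) = ∑ j ∈ J, F j) ∧
      (∀ F : ℕ → ℝ, ∑ j ∈ Finset.range J.card, F (φ j) = ∑ j ∈ J, F j) ∧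
      ellLength T J.card (fun j => q (φ j)) ≤ ellLength T m q := by
  set k := J.card with hk
  have hk0 : 0 < k := hne.card_pos
  set e : Fin k ↪o ℕ := J.orderEmbOfFin rfl with he
  have hem : ∀ i, e i < m := fun i =>
    Finset.mem_range.1 (hJ (Finset.orderEmbOfFin_mem J rfl i))
  set φ : ℕ → ℕ := fun j => e ⟨j % k, Nat.mod_lt _ hk0⟩ with hφ
  have hφp : Function.Periodic φ k := fun j => by simp only [hφ, Nat.add_mod_right]
  have hmap : Finset.univ.map e.toEmbedding = J := by simp [he]
  refine ⟨φ, hφp, fun F => (sum_range_mod hk0 fun i => F (e i)).trans ?_,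
    fun F => (sum_range_mod hk0 fun i => F (e i)).trans ?_, ?_⟩
  · rw [← hmap]
    exact (Finset.sum_map _ _ _).symm
  · rw [← hmap]
    exact (Finset.sum_map _ _ _).symm
  -- Unrolls `φ` over one period, closing at `m + φ 0` instead of `φ 0`, so that the index intervals
  -- are increasing and cover exactly one period of `q`.
  set ψ : ℕ → ℕ := fun j => if j < k then φ j else m + φ 0 with hψ
  have hqψ : ∀ j ≤ k, q (φ j) = q (ψ j) := by
    intro j hj
    simp only [hψ]
    split_ifs with h
    · rfl
    · rw [show j = k by omega, hφp.eq, add_comm, hq]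
  have hmono : ∀ j < k, ψ j ≤ ψ (j + 1) := by
    intro j hj
    simp only [hψ, hj, if_true]
    split_ifs with h
    · refine e.monotone ?_
      rw [Fin.mk_le_mk, Nat.mod_eq_of_lt hj, Nat.mod_eq_of_lt h]
      omega
    · exact (hem _).le.trans (Nat.le_add_right _ _)
  have h0 : ψ 0 = φ 0 := by simp [hψ, hk0]
  have h1 : ψ k = φ 0 + m := by simp [hψ, add_comm]
  calc ellLength T k (fun j => q (φ j))
      ≤ ∑ j ∈ Finset.range k, ∑ i ∈ Finset.Ico (ψ j) (ψ (j + 1)),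
          gauge (polarBody T) (q (i + 1) - q i) := by
        refine Finset.sum_le_sum fun j hj => ?_
        have hj := Finset.mem_range.1 hj
        simp only [hqψ j hj.le, hqψ (j + 1) hj]
        exact gauge_polarBody_sub_le_sum hT q (hmono j hj)
    _ = ellLength T m q := by
        rw [(sum_Ico_telescope _ hmono).2, h0, h1]
        exact sum_Ico_of_periodic (F := fun i => gauge (polarBody T) (q (i + 1) - q i))
          (fun i => by simp only [add_right_comm i m 1, hq _]) _

/-- A billiard trajectory contains a tight polygon with at most `dim E + 1` vertices. -/
theorem IsBilliardPair.exists_mem_tightPolygons [FiniteDimensional ℝ E] (hK : IsConvexBody K)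
    (hT : IsConvexBody T) {m : ℕ} {q p : ℕ → E} (h : IsBilliardPair K T m q p) :
    ∃ k, 0 < k ∧ k ≤ Module.finrank ℝ E + 1 ∧
      ∃ x ∈ tightPolygons K k, ellLength T k x.1 ≤ ellLength T m q := by
  have hw := h.isWeakPair hK hT
  have hpos := h.ellLength_pos hK hT
  have hsub : ∀ j, p j - p (j + 1) ∈ normalCone K (q (j + 1)) := fun j => by
    have := h.dual_sub_mem j
    rwa [neg_sub] at this
  rw [hw.ellLength_eq hT, ← sum_inner_sub_eq hw.periodic hw.periodic_dual] at hpos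
  -- The steps of `p` are normals to `K` with vanishing sum; the selected positive combination is a
  -- certificate for the vertices kept.
  obtain ⟨J, c, hJ, hJcard, hc, hcu, hcb⟩ := exists_small_vanishing_sum
    (u := fun j => p j - p (j + 1)) (fun j => hK.inner_nonneg (hsub j))
    (fun j hj => hK.eq_zero_of_inner_eq_zero (hsub j) hj) hpos
    (by rw [Finset.sum_range_sub', hw.periodic_dual.eq, sub_self])
  have hne : J.Nonempty := by
    rw [Finset.nonempty_iff_ne_empty]
    rintro rfl
    simp at hcb
  have hq1 : Function.Periodic (fun j => q (j + 1)) m := fun j => by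
    simp only [add_right_comm j m 1, hw.periodic _]
  obtain ⟨φ, hφ, hsumE, hsumR, hle⟩ := exists_subpolygon hT hq1 hJ hne
  refine ⟨J.card, hne.card_pos, hJcard,
    (fun j => q (φ j + 1), fun j => c (φ j) • (p (φ j) - p (φ j + 1))),
    ⟨fun j => by simp only [hφ j], fun j => by simp only [hφ j], fun j => hw.mem _,
      fun j => smul_mem_normalCone (hsub _) (hc _), ?_, ?_⟩, hle.trans_eq ?_⟩
  · exact (hsumE fun j => c j • (p j - p (j + 1))).trans hcu
  · simp only [real_inner_smul_left]
    exact (hsumR fun j => c j * inner ℝ (p j - p (j + 1)) (q (j + 1))).trans hcb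
  · exact sum_range_succ_of_periodic (F := fun j => gauge (polarBody T) (q (j + 1) - q j))
      fun j => by simp only [add_right_comm j m 1, hw.periodic _]

/-- A segment traversed back and forth that is longer than the diameter of `K` does not fit, and its
shrunken copy is tight. -/
theorem tightPolygons_two_nonempty [CompleteSpace E] [Nontrivial E] (hK : IsConvexBody K) :
    (tightPolygons K 2).Nonempty := by
  obtain ⟨R, hR⟩ := hK.isCompact.isBounded.exists_norm_le
  obtain ⟨v, hv⟩ := exists_norm_eq E (c := 2 * R + 1) (by
    have := (norm_nonneg _).trans (hR 0 hK.zero_mem)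
    positivity)
  -- The length bound is discarded, so the choice of `K` as `T` is arbitrary.
  obtain ⟨x, hx, -⟩ := exists_tight_ellLength_le (T := K) hK two_pos
    (q := fun j => if j % 2 = 0 then v else 0) (fun j => by simp only [Nat.add_mod_right])
    fun c => by
      by_contra! hcon
      have h0 := hR _ (interior_subset (hcon 0))
      have h1 := hR _ (interior_subset (hcon 1))
      simp only [Nat.zero_mod, if_true, Nat.one_mod, one_ne_zero, if_false, zero_add] at h0 h1
      have := norm_sub_le (v + c) c
      rw [add_sub_cancel_right, hv] at this
      linarith
  exact ⟨x, hx⟩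

/-- There is a weak billiard trajectory that is not longer than any billiard trajectory. -/
theorem exists_isWeakPair_le [FiniteDimensional ℝ E] [Nontrivial E] (hK : IsConvexBody K)
    (hT : IsConvexBody T) :
    ∃ k q p, IsWeakPair K T k q p ∧ 0 < ellLength T k q ∧
      ∀ m' q' p', IsBilliardPair K T m' q' p' → ellLength T k q ≤ ellLength T m' q' := by
  have : CompleteSpace E := FiniteDimensional.complete ℝ E
  set N := Module.finrank ℝ E + 1 with hN
  have hN2 : 2 ≤ N := by
    have : 0 < Module.finrank ℝ E := Module.finrank_pos
    omega
  set S : Set ℝ := ⋃ k ∈ Finset.Icc 1 N, (fun x => ellLength T k x.1) '' tightPolygons K k with hS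
  have hcpt : IsCompact S := by
    refine (Finset.Icc 1 N).isCompact_biUnion fun k hk => ?_
    refine (isCompact_tightPolygons hK (Finset.mem_Icc.1 hk).1).image ?_
    have hc : ∀ j, Continuous fun x : (ℕ → E) × (ℕ → E) => x.1 (j + 1) - x.1 j := fun j => by
      fun_prop
    exact continuous_finsetSum _ fun j _ => hT.continuous_gauge_polarBody.comp (hc j)
  have hmemS : ∀ {l}, l ∈ S ↔ ∃ k, (1 ≤ k ∧ k ≤ N) ∧ ∃ x ∈ tightPolygons K k,
      ellLength T k x.1 = l := by
    intro l
    simp only [hS, mem_iUnion, Finset.mem_Icc, exists_prop, mem_image]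
  obtain ⟨x₀, hx₀⟩ := tightPolygons_two_nonempty hK
  obtain ⟨l, hl, hmin⟩ := hcpt.exists_isLeast ⟨_, hmemS.2 ⟨2, ⟨by omega, hN2⟩, x₀, hx₀, rfl⟩⟩
  obtain ⟨k, ⟨hk1, hkN⟩, ⟨q, w⟩, hx, rfl⟩ := hmemS.1 hl
  obtain ⟨p, hp⟩ := exists_isWeakPair_of_minimal hK hT hk1 hx fun x hx' =>
    hmin (hmemS.2 ⟨k, ⟨hk1, hkN⟩, x, hx', rfl⟩)
  refine ⟨k, q, p, hp, ellLength_pos_of_mem_tightPolygons hT hx, fun m' q' p' h' => ?_⟩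
  obtain ⟨k', hk', hkN', x, hx', hle⟩ := h'.exists_mem_tightPolygons hK hT
  exact (hmin (hmemS.2 ⟨k', ⟨hk', hkN'⟩, x, hx', rfl⟩)).trans hle

/-- The shortest tight polygon need not be a proper billiard trajectory, but a weak pair suffices to
produce a closed characteristic. The lower bound holds because every action is the length of a
billiard trajectory. -/
theorem isLeast_actions [FiniteDimensional ℝ E] [Nontrivial E] (hK : IsConvexPolytope K)
    (hT : IsConvexBody T) (hTs : StrictConvex ℝ T) :
    IsLeast (actions (K ×ˢ T)) (ehzCapacity (K ×ˢ T)) := by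
  obtain ⟨k, q, p, hqp, hpos, hmin⟩ := exists_isWeakPair_le hK.isConvexBody hT
  obtain ⟨x, hx, -⟩ := hqp.exists_isClosedCharacteristic hK.isConvexBody hT hpos
  have hleast : IsLeast (actions (K ×ˢ T)) (ellLength T k q) := by
    refine ⟨⟨_, x, hx, by rw [hx.action_eq]; ring⟩, ?_⟩
    rintro _ ⟨τ', x', hx', rfl⟩
    obtain ⟨m', q', p', h', -, -, hτ'⟩ := hx'.exists_isBilliardPair hK hT hTs
    rw [hx'.action_eq, hτ']
    have := hmin m' q' p' h'
    linarith
  rwa [ehzCapacity, hleast.csInf_eq]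

theorem actions_eq_billiardLengths (hK : IsConvexPolytope K) (hT : IsConvexBody T)
    (hTs : StrictConvex ℝ T) : actions (K ×ˢ T) = billiardLengths K T := by
  ext l
  constructor
  · rintro ⟨τ, x, hx, rfl⟩
    obtain ⟨m, q, p, h, -, -, hτ⟩ := hx.exists_isBilliardPair hK hT hTs
    refine ⟨m, q, ⟨p, h⟩, ?_⟩
    rw [hx.action_eq, hτ]
    ring
  · rintro ⟨m, q, ⟨p, h⟩, rfl⟩
    obtain ⟨x, hx, -⟩ := (h.isWeakPair hK.isConvexBody hT).exists_isClosedCharacteristic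
      hK.isConvexBody hT (h.ellLength_pos hK.isConvexBody hT)
    exact ⟨_, x, hx, by rw [hx.action_eq]; ring⟩

/-- A closed characteristic and a billiard trajectory of the same action and length are
minimizing simultaneously. -/
theorem isActionMinimizing_iff {τ : ℝ} {x : ℝ → E × E} {m : ℕ} {q p : ℕ → E}
    (hK : IsConvexPolytope K) (hT : IsConvexBody T) (hTs : StrictConvex ℝ T)
    (hx : IsClosedCharacteristic (K ×ˢ T) τ x) (h : IsBilliardPair K T m q p)
    (heq : action τ x = ellLength T m q) :
    IsActionMinimizing (K ×ˢ T) τ x ↔ IsLengthMinimizing K T m q := by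
  have hset := actions_eq_billiardLengths hK hT hTs
  constructor
  · rintro ⟨-, hmin⟩
    refine ⟨⟨p, h⟩, fun m' q' h' => ?_⟩
    obtain ⟨τ', x', hx', he⟩ : ellLength T m' q' ∈ actions (K ×ˢ T) := by
      rw [hset]
      exact ⟨m', q', h', rfl⟩
    rw [← heq, he]
    exact hmin τ' x' hx'
  · rintro ⟨-, hmin⟩
    refine ⟨hx, fun τ' x' hx' => ?_⟩
    obtain ⟨m', q', h', he⟩ : action τ' x' ∈ billiardLengths K T := by
      rw [← hset]
      exact ⟨τ', x', hx', rfl⟩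
    rw [heq, he]
    exact hmin m' q' h'

end

end MinkowskiBilliard

open MinkowskiBilliard in
theorem theorem3p1 {n : ℕ} (hn : 1 ≤ n) (K T : Set (EuclideanSpace ℝ (Fin n)))
    (hK : IsConvexPolytope K) (hT : IsConvexBody T) (hTs : StrictConvex ℝ T) :
    (∀ (τ : ℝ) (x : ℝ → EuclideanSpace ℝ (Fin n) × EuclideanSpace ℝ (Fin n)),
      IsClosedCharacteristic (K ×ˢ T) τ x →
      ∃ (τ' : ℝ) (x' : ℝ → EuclideanSpace ℝ (Fin n) × EuclideanSpace ℝ (Fin n))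
        (m : ℕ) (q p : ℕ → EuclideanSpace ℝ (Fin n)),
        IsClosedCharacteristic (K ×ˢ T) τ' x' ∧
        IsPolygonalLoop τ' x' m q p ∧
        IsBilliardPair K T m q p ∧
        HasChangingPoints τ x m q p ∧
        HasChangingPoints τ' x' m q p ∧
        action τ x = action τ' x' ∧
        action τ' x' = ellLength T m q ∧
        (IsActionMinimizing (K ×ˢ T) τ x →
          IsActionMinimizing (K ×ˢ T) τ' x' ∧ IsLengthMinimizing K T m q)) ∧
    (∀ (m : ℕ) (q p : ℕ → EuclideanSpace ℝ (Fin n)),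
      IsBilliardPair K T m q p →
      ∃ (τ : ℝ) (x : ℝ → EuclideanSpace ℝ (Fin n) × EuclideanSpace ℝ (Fin n)),
        IsClosedCharacteristic (K ×ˢ T) τ x ∧
        IsPolygonalLoop τ x m q p ∧
        ellLength T m q = action τ x ∧
        (IsLengthMinimizing K T m q → IsActionMinimizing (K ×ˢ T) τ x)) ∧
    IsLeast (actions (K ×ˢ T)) (ehzCapacity (K ×ˢ T)) ∧
    IsLeast (billiardLengths K T) (ehzCapacity (K ×ˢ T)) := by
  have : Nonempty (Fin n) := ⟨⟨0, hn⟩⟩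
  have hKb := hK.isConvexBody
  have hleast := isLeast_actions hK hT hTs
  refine ⟨fun τ x hx => ?_, fun m q p h => ?_, hleast,
    actions_eq_billiardLengths hK hT hTs ▸ hleast⟩
  · obtain ⟨m, q, p, h, hp, hcp, hτ⟩ := hx.exists_isBilliardPair hK hT hTs
    obtain ⟨x', hx', hloop⟩ := (h.isWeakPair hKb hT).exists_isClosedCharacteristic hKb hT
      (h.ellLength_pos hKb hT)
    have ha : action τ x = ellLength T m q := by
      rw [hx.action_eq, hτ]
      ring
    have ha' : action (2 * ellLength T m q) x' = ellLength T m q := by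
      rw [hx'.action_eq]
      ring
    refine ⟨_, x', m, q, p, hx', hloop, h, hcp, hloop.hasChangingPoints h.polygon.ne_succ hp,
      ha.trans ha'.symm, ha', fun hmin => ?_⟩
    have hlen := (isActionMinimizing_iff hK hT hTs hx h ha).1 hmin
    exact ⟨(isActionMinimizing_iff hK hT hTs hx' h ha').2 hlen, hlen⟩
  · obtain ⟨x, hx, hloop⟩ := (h.isWeakPair hKb hT).exists_isClosedCharacteristic hKb hT
      (h.ellLength_pos hKb hT)
    have ha : action (2 * ellLength T m q) x = ellLength T m q := by
      rw [hx.action_eq]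
      ring
    exact ⟨_, x, hx, hloop, ha.symm, (isActionMinimizing_iff hK hT hTs hx h ha).2⟩
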